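/- Let $P_5=\mathbb F_2[x_1,\dots,x_5]$, graded with every $x_i$ in degree $1$ and regarded as a module over the mod-$2$ Steenrod algebra $\mathcal A$ (so $Sq^0=\mathrm{id}$, $Sq^1x_i=x_i^2$, $Sq^nx_i=0$ for $n>1$, and the Cartan formula holds). Let $\mathcal A^+P_5=\sum_{n\ge 1}Sq^n(P_5)$ be the subspace of hit polynomials, and let $GL_5=GL_5(\mathbb F_2)$ act on $P_5$ by linear substitutions of the variables. For a monomial $x=x_1^{\nu_1}\cdots x_5^{\nu_5}$ let $\omega_i(x)$, $i\ge1$, be the number of $j$ such that the coefficient of $2^{i-1}$ in the binary expansion of $\nu_j$ is $1$, and let $\omega(x)=(\omega_1(x),\omega_2(x),\dots)$ be its weight vector. Weight vectors and exponent vectors are ordered left-lexicographically. For monomials $x,y$ of the same degree, $x<y$ means that $\omega(x)<\omega(y)$, or $\omega(x)=\omega(y)$ and $(\nu_1(x),\dots,\nu_5(x))<(\nu_1(y),\dots,\nu_5(y))$. A monomial $x$ is inadmissible if $x+y_1+\cdots+y_t\in\mathcal A^+P_5$ for some monomials $y_1,\dots,y_t<x$ ($t\ge 0$), and admissible otherwise.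 For a sequence $\omega=(\omega_1,\omega_2,\dots)$ of non-negative integers, almost all zero, put $\deg\omega=\sum_i2^{i-1}\omega_i$. Let $P_5(\omega)$ (respectively $P_5^-(\omega)$) be the span of the monomials $y$ with $\deg y=\deg\omega$ and $\omega(y)\le\omega$ (respectively $\omega(y)<\omega$). Put $$QP_5(\omega)=P_5(\omega)/\big((\mathcal A^+P_5\cap P_5(\omega))+P_5^-(\omega)\big),$$ with the induced action of $GL_5$, and write $[f]_\omega$ for the class of $f\in P_5(\omega)$. Let $B_5(\omega)$ be the set of admissible monomials $x$ with $\omega(x)=\omega$. Let $\omega_{(4)}=(3,4,2,2)$ and $\omega_{(5)}=(3,4,4,1)$ (both of degree $35$), and let $a_t$, $161\le t\le 225$, be the monomials with the following exponent vectors $(\nu_1,\dots,\nu_5)$: $$\begin{aligned} a_{161}&:(1,2,7,11,14), & a_{162}&:(1,7,2,11,14), & a_{163}&:(1,7,11,2,14), & a_{164}&:(1,7,11,14,2), & a_{165}&:(7,1,2,11,14) \\ a_{166}&:(7,1,11,2,14), & a_{167}&:(7,1,11,14,2), & a_{168}&:(7,11,1,2,14), & a_{169}&:(7,11,1,14,2),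 & a_{170}&:(7,11,13,2,2) \\ a_{171}&:(1,3,6,11,14), & a_{172}&:(3,1,6,11,14), & a_{173}&:(1,3,7,10,14), & a_{174}&:(1,3,7,14,10), & a_{175}&:(1,7,3,10,14) \\ a_{176}&:(1,7,3,14,10), & a_{177}&:(3,1,7,10,14), & a_{178}&:(3,1,7,14,10), & a_{179}&:(3,7,1,10,14), & a_{180}&:(3,7,1,14,10) \\ a_{181}&:(7,1,3,10,14), & a_{182}&:(7,1,3,14,10), & a_{183}&:(7,3,1,10,14), & a_{184}&:(7,3,1,14,10), & a_{185}&:(1,7,11,6,10) \\ a_{186}&:(7,1,11,6,10), & a_{187}&:(7,11,1,6,10), & a_{188}&:(3,5,2,11,14), & a_{189}&:(3,5,11,2,14), & a_{190}&:(3,5,11,14,2) \\ a_{191}&:(3,7,9,2,14), & a_{192}&:(3,7,9,14,2), & a_{193}&:(7,3,9,2,14), & a_{194}&:(7,3,9,14,2), & a_{195}&:(3,7,13,2,10) \\ a_{196}&:(3,7,13,10,2), & a_{197}&:(7,3,13,2,10), & a_{198}&:(7,3,13,10,2), & a_{199}&:(7,11,5,2,10), & a_{200}&:(7,11,5,10,2)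 \\ a_{201}&:(3,3,5,10,14), & a_{202}&:(3,3,5,14,10), & a_{203}&:(3,5,3,10,14), & a_{204}&:(3,5,3,14,10), & a_{205}&:(3,3,13,6,10) \\ a_{206}&:(3,5,11,6,10), & a_{207}&:(3,7,5,10,10), & a_{208}&:(7,3,5,10,10), & a_{209}&:(3,7,9,6,10), & a_{210}&:(7,3,9,6,10) \end{aligned}$$ $$\begin{aligned} a_{211}&:(3,5,6,6,15), & a_{212}&:(3,5,6,15,6), & a_{213}&:(3,5,15,6,6), & a_{214}&:(3,15,5,6,6), & a_{215}&:(15,3,5,6,6) \\ a_{216}&:(3,5,6,7,14), & a_{217}&:(3,5,7,6,14), & a_{218}&:(3,5,7,14,6), & a_{219}&:(3,7,5,6,14), & a_{220}&:(3,7,5,14,6) \\ a_{221}&:(3,7,13,6,6), & a_{222}&:(7,3,5,6,14), & a_{223}&:(7,3,5,14,6), & a_{224}&:(7,3,13,6,6), & a_{225}&:(7,11,5,6,6) \end{aligned}$$ Then: (1) $B_5(\omega_{(4)})=\{a_t: 161\le t\le 210\}$; the classes $[a_t]_{\omega_{(4)}}$, $161\le t\le 210$, form a basis of the $\mathbb F_2$-vector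 space $QP_5(\omega_{(4)})$, so that $\dim QP_5(\omega_{(4)})=50$; and $QP_5(\omega_{(4)})$ is generated as a $GL_5$-module by $[a_{203}]_{\omega_{(4)}}$. (2) $B_5(\omega_{(5)})=\{a_t: 211\le t\le 225\}$; the classes $[a_t]_{\omega_{(5)}}$, $211\le t\le 225$, form a basis of the $\mathbb F_2$-vector space $QP_5(\omega_{(5)})$, so that $\dim QP_5(\omega_{(5)})=15$; and $QP_5(\omega_{(5)})$ is generated as a $GL_5$-module by $[a_{225}]_{\omega_{(5)}}$. -/

import Mathlib

open MvPolynomial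

namespace HitProblem

/-- The polynomial algebra `P_k = 𝔽₂[x_1, …, x_k]`. The variable `x_{i+1}` is `X i`, `i : Fin k`. -/
abbrev P (k : ℕ) : Type := MvPolynomial (Fin k) (ZMod 2)

/-- The monomial `x_1^{a_1} ⋯ x_k^{a_k}` with exponent vector `a`. Monomials are identified with
their exponent vectors. -/
noncomputable abbrev mono {k : ℕ} (a : Fin k →₀ ℕ) : P k := monomial a 1

section Steenrod

/-- The total Steenrod square `Sq = ∑ₙ Sqⁿ Tⁿ : P_k → P_k[T]`. By the Cartan formula it is the ring
homomorphism determined by `Sq(x_i) = x_i + x_i² T`, as every `x_i` has degree one. -/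
noncomputable def totalSq (k : ℕ) : P k →ₐ[ZMod 2] Polynomial (P k) :=
  aeval fun i => Polynomial.C (X i) + Polynomial.C (X i ^ 2) * Polynomial.X

/-- The Steenrod square `Sqⁿ : P_k → P_k`, the coefficient of `Tⁿ` in the total square. -/
noncomputable def sq (k n : ℕ) : P k →ₗ[ZMod 2] P k :=
  ((Polynomial.lcoeff (P k) n).restrictScalars (ZMod 2)) ∘ₗ (totalSq k).toLinearMap

/-- The space `𝒜⁺P_k` of hit polynomials. The augmentation ideal `𝒜⁺` of the Steenrod algebra is
spanned by the nonempty composites of the `Sqⁿ`, `n ≥ 1`, so that `𝒜⁺P_k` is the sum of the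
images of the `Sqⁿ` with `n ≥ 1`. -/
noncomputable def hit (k : ℕ) : Submodule (ZMod 2) (P k) :=
  ⨆ n ≥ 1, LinearMap.range (sq k n)

end Steenrod

section Weight

/-- The weight vector `ω(x)` of a monomial: `weight x i = ω_{i+1}(x)` is the number of exponents of
`x` whose `i`-th binary digit is one. Sequences `(ω_1, ω_2, …)` are indexed from `0` here. -/
noncomputable def weight {k : ℕ} (x : Fin k →₀ ℕ) : ℕ →₀ ℕ :=
  Finsupp.onFinset (Finset.range x.degree) (fun i => ∑ j, x j / 2 ^ i % 2) (by
    intro i hi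
    rw [Finset.mem_range]
    obtain ⟨j, -, hj⟩ := Finset.exists_ne_zero_of_sum_ne_zero hi
    have h1 : i < x j := by
      by_contra h
      rw [Nat.div_eq_of_lt (lt_of_le_of_lt (not_lt.mp h) Nat.lt_two_pow_self)] at hj
      exact hj rfl
    exact h1.trans_le (Finsupp.le_degree j x))

/-- `deg ω = ∑ 2^{i-1} ω_i`. -/
def wdeg (ω : ℕ →₀ ℕ) : ℕ := ω.sum fun i a => 2 ^ i * a

/-- `P_k(ω)`: the span of the monomials `y` with `deg y = deg ω` and `ω(y) ≤ ω` in the left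
lexicographical order. -/
noncomputable def PLe (k : ℕ) (ω : ℕ →₀ ℕ) : Submodule (ZMod 2) (P k) :=
  Submodule.span (ZMod 2) {f | ∃ y : Fin k →₀ ℕ, y.degree = wdeg ω ∧
    toLex (weight y) ≤ toLex ω ∧ f = mono y}

/-- `P_k⁻(ω)`: the span of the monomials `y` with `deg y = deg ω` and `ω(y) < ω`. -/
noncomputable def PLt (k : ℕ) (ω : ℕ →₀ ℕ) : Submodule (ZMod 2) (P k) :=
  Submodule.span (ZMod 2) {f | ∃ y : Fin k →₀ ℕ, y.degree = wdeg ω ∧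
    toLex (weight y) < toLex ω ∧ f = mono y}

/-- The order on monomials of the same degree: first by weight vector, then by exponent vector, both
in the left lexicographical order. -/
def MonoLT {k : ℕ} (x y : Fin k →₀ ℕ) : Prop :=
  x.degree = y.degree ∧ (toLex (weight x) < toLex (weight y) ∨
    (weight x = weight y ∧ toLex x < toLex y))

/-- `x` is inadmissible if `x + y_1 + ⋯ + y_t` is hit for some monomials `y_1, …, y_t < x`
(repeated `y_j` cancel in pairs, so they may be taken distinct). -/
def Inadmissible {k : ℕ} (x : Fin k →₀ ℕ) : Prop :=
  ∃ S : Finset (Fin k →₀ ℕ), (∀ y ∈ S, MonoLT y x) ∧ mono x + ∑ y ∈ S, mono y ∈ hit k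

/-- `B_k(ω)`: the admissible monomials with weight vector `ω`. -/
def admissibleMonomials (k : ℕ) (ω : ℕ →₀ ℕ) : Set (Fin k →₀ ℕ) :=
  {x | ¬ Inadmissible x ∧ weight x = ω}

end Weight

section Quotient

/-- The denominator `(𝒜⁺P_k ∩ P_k(ω)) + P_k⁻(ω)`, as a subspace of `P_k(ω)`. -/
noncomputable def relations (k : ℕ) (ω : ℕ →₀ ℕ) : Submodule (ZMod 2) (PLe k ω) :=
  ((hit k ⊓ PLe k ω) ⊔ PLt k ω).submoduleOf (PLe k ω)

/-- `QP_k(ω) = P_k(ω) / ((𝒜⁺P_k ∩ P_k(ω)) + P_k⁻(ω))`. -/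
abbrev QP (k : ℕ) (ω : ℕ →₀ ℕ) : Type := PLe k ω ⧸ relations k ω

/-- The class `[f]_ω` of `f ∈ P_k(ω)`. -/
noncomputable def cls {k : ℕ} {ω : ℕ →₀ ℕ} (f : P k) (hf : f ∈ PLe k ω) : QP k ω :=
  (relations k ω).mkQ ⟨f, hf⟩

end Quotient

section Action

/-- The algebra endomorphism of `P_k` extending the linear map of `⟨x_1, …, x_k⟩` with matrix `A` in
the basis `x_1, …, x_k`, i.e. `x_i ↦ ∑_j A_{ji} x_j`. -/
noncomputable def subst {k : ℕ} (A : Matrix (Fin k) (Fin k) (ZMod 2)) : P k →ₐ[ZMod 2] P k :=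
  aeval fun i => ∑ j, C (A j i) * X j

theorem subst_one (k : ℕ) : subst (1 : Matrix (Fin k) (Fin k) (ZMod 2)) = AlgHom.id _ _ := by
  apply MvPolynomial.algHom_ext
  intro i
  simp [subst, Matrix.one_apply]

theorem subst_mul {k : ℕ} (A B : Matrix (Fin k) (Fin k) (ZMod 2)) :
    subst (A * B) = (subst A).comp (subst B) := by
  apply MvPolynomial.algHom_ext
  intro i
  simp only [subst, Matrix.mul_apply, aeval_X, AlgHom.comp_apply, map_sum, map_mul,
    Finset.sum_mul, Finset.mul_sum]
  rw [Finset.sum_comm]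
  refine Finset.sum_congr rfl fun l _ => Finset.sum_congr rfl fun j _ => ?_
  rw [← algebraMap_eq, AlgHom.commutes]
  ring

/-- The action of `GL_k = GL_k(𝔽₂)` on `P_k` by linear substitution of the variables. -/
noncomputable def polyRep (k : ℕ) : Representation (ZMod 2) (GL (Fin k) (ZMod 2)) (P k) where
  toFun g := (subst (g : Matrix (Fin k) (Fin k) (ZMod 2))).toLinearMap
  map_one' := by
    rw [Units.val_one, subst_one]
    rfl
  map_mul' g h := by
    rw [Units.val_mul, subst_mul]
    rfl

theorem subst_sq {k : ℕ} (A : Matrix (Fin k) (Fin k) (ZMod 2)) (n : ℕ) (f : P k) :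
    subst A (sq k n f) = sq k n (subst A f) := by
  have key : (Polynomial.mapAlgHom (subst A)).comp (totalSq k) = (totalSq k).comp (subst A) := by
    apply MvPolynomial.algHom_ext
    intro i
    have hs : (∑ j, C (A j i) * X j : P k) ^ 2 = ∑ j, C (A j i) * X j ^ 2 := by
      rw [sum_pow_char 2]
      refine Finset.sum_congr rfl fun j _ => ?_
      rw [mul_pow, ← C_pow, ZMod.pow_card]
    have hc : ∀ a : ZMod 2, totalSq k (C a) = Polynomial.C (C a) := fun a => by
      rw [← algebraMap_eq, AlgHom.commutes]; rfl
    have hx : ∀ j, totalSq k (X j) = Polynomial.C (X j) + Polynomial.C (X j ^ 2) * Polynomial.X :=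
      fun j => by rw [totalSq, aeval_X]
    have hA : subst A (X i) = ∑ j, C (A j i) * X j := by rw [subst, aeval_X]
    rw [AlgHom.comp_apply, AlgHom.comp_apply, hA, hx]
    simp only [map_sum, map_mul, hc, hx, Polynomial.coe_mapAlgHom, Polynomial.map_add,
      Polynomial.map_mul, Polynomial.map_C, Polynomial.map_X, RingHom.coe_coe, hA, map_pow,
      mul_add, Finset.sum_add_distrib]
    have h2 : Polynomial.map (subst A : P k →+* P k) (Polynomial.C (X i) ^ 2)
        = ∑ j, Polynomial.C (C (A j i)) * Polynomial.C (X j) ^ 2 := by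
      rw [← Polynomial.C_pow, Polynomial.map_C, RingHom.coe_coe, map_pow, hA, hs]
      simp only [map_sum, map_mul, map_pow]
    refine congrArg₂ (· + ·) rfl ((congrArg (· * Polynomial.X) h2).trans ?_)
    simp only [Finset.sum_mul, mul_assoc]
  have h := congrArg (fun p => Polynomial.coeff p n) (DFunLike.congr_fun key f)
  simpa [sq] using h

theorem subst_mem_hit {k : ℕ} (A : Matrix (Fin k) (Fin k) (ZMod 2)) {f : P k} (hf : f ∈ hit k) :
    subst A f ∈ hit k := by
  have : hit k ≤ (hit k).comap (subst A).toLinearMap := by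
    refine iSup₂_le fun n hn => ?_
    rintro _ ⟨g, rfl⟩
    change subst A (sq k n g) ∈ hit k
    rw [subst_sq]
    exact (le_iSup₂ (f := fun n (_ : n ≥ 1) => LinearMap.range (sq k n)) n hn) ⟨_, rfl⟩
  exact this hf

theorem weight_apply {k : ℕ} (x : Fin k →₀ ℕ) (i : ℕ) : weight x i = ∑ j, x j / 2 ^ i % 2 := rfl

theorem lex_le_of_head {a b : ℕ →₀ ℕ} (h0 : a 0 ≤ b 0)
    (h : a 0 = b 0 → ∃ a' b' : ℕ →₀ ℕ, (∀ i, a (i + 1) = a' i) ∧ (∀ i, b (i + 1) = b' i) ∧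
      toLex a' ≤ toLex b') : toLex a ≤ toLex b := by
  rcases h0.lt_or_eq with h0 | h0
  · exact le_of_lt (Finsupp.Lex.lt_iff.2 ⟨0, fun j hj => absurd hj (Nat.not_lt_zero j), h0⟩)
  · obtain ⟨a', b', ha, hb, hab⟩ := h h0
    rcases hab.lt_or_eq with hlt | heq
    · obtain ⟨i, hi, hi'⟩ := Finsupp.Lex.lt_iff.1 hlt
      refine le_of_lt (Finsupp.Lex.lt_iff.2 ⟨i + 1, fun j hj => ?_, ?_⟩)
      · cases j with
        | zero => exact h0
        | succ j => simpa [ha, hb] using hi j (by omega)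
      · simpa [ha, hb] using hi'
    · have hab' : a' = b' := toLex.injective heq
      subst hab'
      refine le_of_eq (congrArg toLex (Finsupp.ext fun j => ?_))
      cases j with
      | zero => exact h0
      | succ j => rw [ha, hb]

/-- Every monomial of the image of a monomial under a linear substitution has the same degree and a
smaller or equal weight vector. -/
theorem subst_mono_support {k : ℕ} (A : Matrix (Fin k) (Fin k) (ZMod 2)) (n : ℕ) :
    ∀ x : Fin k →₀ ℕ, (∀ j, x j < 2 ^ n) → ∀ y ∈ (subst A (mono x)).support,
      y.degree = x.degree ∧ toLex (weight y) ≤ toLex (weight x) := by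
  classical
  have hom : ∀ u : Fin k →₀ ℕ, (subst A (mono u)).IsHomogeneous u.degree := by
    intro u
    have h1 : ∀ i, (∑ j, C (A j i) * X j : P k).IsHomogeneous 1 := fun i =>
      IsHomogeneous.sum _ _ _ fun j _ => by
        simpa using (isHomogeneous_C (Fin k) (A j i)).mul (isHomogeneous_X (ZMod 2) j)
    simpa [subst] using (isHomogeneous_monomial (σ := Fin k) (1 : ZMod 2) rfl).aeval _ h1
  have hdeg : ∀ (u y : Fin k →₀ ℕ), y ∈ (subst A (mono u)).support → y.degree = u.degree := by
    intro u y hy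
    have h := hom u (mem_support_iff.1 hy)
    rw [← h, Finsupp.degree_eq_weight_one]
    rfl
  induction n with
  | zero =>
    intro x hx y hy
    have hx0 : x = 0 := Finsupp.ext fun j => by simpa using hx j
    subst hx0
    have : subst A (mono (0 : Fin k →₀ ℕ)) = mono 0 := by
      change subst A 1 = 1
      exact map_one _
    rw [this] at hy
    have hy0 : y = 0 := by simpa using support_monomial_subset hy
    subst hy0
    exact ⟨rfl, le_rfl⟩
  | succ n ih =>
    intro x hx y hy
    refine ⟨hdeg x y hy, ?_⟩
    let u : Fin k →₀ ℕ := x.mapRange (fun a => a % 2) rfl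
    let z : Fin k →₀ ℕ := x.mapRange (fun a => a / 2) rfl
    have hxuz : x = u + 2 • z := Finsupp.ext fun j => by
      simp [u, z, Nat.mod_add_div]
    have hprod : subst A (mono x) = subst A (mono u) * expand 2 (subst A (mono z)) := by
      rw [expand_zmod, ← map_pow, ← map_mul]
      congr 1
      rw [hxuz]
      simp [mono, monomial_pow, monomial_mul]
    rw [hprod] at hy
    obtain ⟨m, hm, q, hq, rfl⟩ := Finset.mem_add.1 (support_mul _ _ hy)
    rw [support_expand _ (by norm_num)] at hq
    obtain ⟨w, hw, rfl⟩ := Finset.mem_image.1 hq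
    have hw' := (ih z (fun j => by
      have := hx j
      simp only [z, Finsupp.mapRange_apply]
      omega) w hw).2
    have hmu := hdeg u m hm
    have hw0 : weight x 0 = u.degree := by
      simp [weight_apply, Finsupp.degree_eq_sum, u]
    have hm0 : weight (m + 2 • w) 0 = ∑ j, m j % 2 := by
      simp [weight_apply]
    have hle : ∀ j ∈ Finset.univ, m j % 2 ≤ m j := fun j _ => Nat.mod_le _ _
    refine lex_le_of_head ?_ fun heq => ⟨weight w, weight z, fun i => ?_, fun i => ?_, hw'⟩
    · rw [hw0, ← hmu, hm0, Finsupp.degree_eq_sum]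
      exact Finset.sum_le_sum hle
    · rw [hw0, ← hmu, hm0, Finsupp.degree_eq_sum, Finset.sum_eq_sum_iff_of_le hle] at heq
      simp only [weight_apply]
      refine Finset.sum_congr rfl fun j _ => ?_
      have := heq j (Finset.mem_univ j)
      simp only [Finsupp.add_apply, Finsupp.smul_apply, smul_eq_mul, pow_succ']
      rw [← Nat.div_div_eq_div_mul]
      congr 2
      omega
    · simp only [weight_apply, z, Finsupp.mapRange_apply, pow_succ', Nat.div_div_eq_div_mul]

theorem subst_mono_support' {k : ℕ} (A : Matrix (Fin k) (Fin k) (ZMod 2)) (x : Fin k →₀ ℕ) :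
    ∀ y ∈ (subst A (mono x)).support,
      y.degree = x.degree ∧ toLex (weight y) ≤ toLex (weight x) :=
  subst_mono_support A x.degree x fun j =>
    (Finsupp.le_degree j x).trans_lt Nat.lt_two_pow_self

theorem mem_span_of_support {k : ℕ} (Q : (Fin k →₀ ℕ) → Prop) (f : P k)
    (h : ∀ y ∈ f.support, Q y) : f ∈ Submodule.span (ZMod 2) {f | ∃ y, Q y ∧ f = mono y} := by
  rw [f.as_sum]
  refine Submodule.sum_mem _ fun y hy => ?_
  have : monomial y (coeff y f) = coeff y f • mono y := by
    rw [smul_monomial, smul_eq_mul, mul_one]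
  rw [this]
  exact Submodule.smul_mem _ _ (Submodule.subset_span ⟨y, h y hy, rfl⟩)

theorem subst_mem_PLe {k : ℕ} (A : Matrix (Fin k) (Fin k) (ZMod 2)) (ω : ℕ →₀ ℕ) {f : P k}
    (hf : f ∈ PLe k ω) : subst A f ∈ PLe k ω := by
  have : PLe k ω ≤ (PLe k ω).comap (subst A).toLinearMap := by
    refine Submodule.span_le.2 ?_
    rintro _ ⟨x, hx, hx', rfl⟩
    have := mem_span_of_support (fun y => y.degree = wdeg ω ∧ toLex (weight y) ≤ toLex ω)
      (subst A (mono x)) fun y hy =>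
        ⟨(subst_mono_support' A x y hy).1.trans hx, (subst_mono_support' A x y hy).2.trans hx'⟩
    simp only [and_assoc] at this
    exact this
  exact this hf

theorem subst_mem_PLt {k : ℕ} (A : Matrix (Fin k) (Fin k) (ZMod 2)) (ω : ℕ →₀ ℕ) {f : P k}
    (hf : f ∈ PLt k ω) : subst A f ∈ PLt k ω := by
  have : PLt k ω ≤ (PLt k ω).comap (subst A).toLinearMap := by
    refine Submodule.span_le.2 ?_
    rintro _ ⟨x, hx, hx', rfl⟩
    have := mem_span_of_support (fun y => y.degree = wdeg ω ∧ toLex (weight y) < toLex ω)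
      (subst A (mono x)) fun y hy =>
        ⟨(subst_mono_support' A x y hy).1.trans hx,
          (subst_mono_support' A x y hy).2.trans_lt hx'⟩
    simp only [and_assoc] at this
    exact this
  exact this hf

/-- The action of `GL_k` on `P_k(ω)`. -/
noncomputable def PLeRep (k : ℕ) (ω : ℕ →₀ ℕ) :
    Representation (ZMod 2) (GL (Fin k) (ZMod 2)) (PLe k ω) :=
  (polyRep k).subrepresentation (PLe k ω) fun _ _ hf => subst_mem_PLe _ ω hf

/-- The action of `GL_k` on `QP_k(ω)`, given by `g [f]_ω = [g f]_ω`. -/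
noncomputable def QPRep (k : ℕ) (ω : ℕ →₀ ℕ) :
    Representation (ZMod 2) (GL (Fin k) (ZMod 2)) (QP k ω) :=
  (PLeRep k ω).quotient (relations k ω) fun g f hf => by
    obtain ⟨a, ha, b, hb, hab⟩ := Submodule.mem_sup.1 (Submodule.mem_comap.1 hf)
    refine Submodule.mem_comap.2 (Submodule.mem_sup.2
      ⟨_, ⟨subst_mem_hit g.1 ha.1, subst_mem_PLe g.1 ω ha.2⟩, _, subst_mem_PLt g.1 ω hb, ?_⟩)
    rw [← map_add, hab]
    rfl

/-- `v` generates the `GL_k`-module `QP_k(ω)`: the only subrepresentation containing `v` is the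
whole space. -/
def Generates {k : ℕ} {ω : ℕ →₀ ℕ} (v : QP k ω) : Prop :=
  ∀ W : Subrepresentation (QPRep k ω), v ∈ W → W.toSubmodule = ⊤

end Action

section Data

/-- The weight vector `ω_(4) = (3,4,2,2)`. -/
def omega4 : ℕ →₀ ℕ := [3, 4, 2, 2].toFinsupp

/-- The weight vector `ω_(5) = (3,4,4,1)`. -/
def omega5 : ℕ →₀ ℕ := [3, 4, 4, 1].toFinsupp

/-- The pairs of an index `t` and the exponent vector `(ν_1, …, ν_5)` of the monomial
`a_t = a_{35,t}`, for `161 ≤ t ≤ 225`. -/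
def aTable : List (ℕ × (Fin 5 → ℕ)) :=
  [(161, ![1, 2, 7, 11, 14]), (162, ![1, 7, 2, 11, 14]), (163, ![1, 7, 11, 2, 14]),
   (164, ![1, 7, 11, 14, 2]), (165, ![7, 1, 2, 11, 14]), (166, ![7, 1, 11, 2, 14]),
   (167, ![7, 1, 11, 14, 2]), (168, ![7, 11, 1, 2, 14]), (169, ![7, 11, 1, 14, 2]),
   (170, ![7, 11, 13, 2, 2]), (171, ![1, 3, 6, 11, 14]), (172, ![3, 1, 6, 11, 14]),
   (173, ![1, 3, 7, 10, 14]), (174, ![1, 3, 7, 14, 10]), (175, ![1, 7, 3, 10, 14]),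
   (176, ![1, 7, 3, 14, 10]), (177, ![3, 1, 7, 10, 14]), (178, ![3, 1, 7, 14, 10]),
   (179, ![3, 7, 1, 10, 14]), (180, ![3, 7, 1, 14, 10]), (181, ![7, 1, 3, 10, 14]),
   (182, ![7, 1, 3, 14, 10]), (183, ![7, 3, 1, 10, 14]), (184, ![7, 3, 1, 14, 10]),
   (185, ![1, 7, 11, 6, 10]), (186, ![7, 1, 11, 6, 10]), (187, ![7, 11, 1, 6, 10]),
   (188, ![3, 5, 2, 11, 14]), (189, ![3, 5, 11, 2, 14]), (190, ![3, 5, 11, 14, 2]),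
   (191, ![3, 7, 9, 2, 14]), (192, ![3, 7, 9, 14, 2]), (193, ![7, 3, 9, 2, 14]),
   (194, ![7, 3, 9, 14, 2]), (195, ![3, 7, 13, 2, 10]), (196, ![3, 7, 13, 10, 2]),
   (197, ![7, 3, 13, 2, 10]), (198, ![7, 3, 13, 10, 2]), (199, ![7, 11, 5, 2, 10]),
   (200, ![7, 11, 5, 10, 2]), (201, ![3, 3, 5, 10, 14]), (202, ![3, 3, 5, 14, 10]),
   (203, ![3, 5, 3, 10, 14]), (204, ![3, 5, 3, 14, 10]), (205, ![3, 3, 13, 6, 10]),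
   (206, ![3, 5, 11, 6, 10]), (207, ![3, 7, 5, 10, 10]), (208, ![7, 3, 5, 10, 10]),
   (209, ![3, 7, 9, 6, 10]), (210, ![7, 3, 9, 6, 10]), (211, ![3, 5, 6, 6, 15]),
   (212, ![3, 5, 6, 15, 6]), (213, ![3, 5, 15, 6, 6]), (214, ![3, 15, 5, 6, 6]),
   (215, ![15, 3, 5, 6, 6]), (216, ![3, 5, 6, 7, 14]), (217, ![3, 5, 7, 6, 14]),
   (218, ![3, 5, 7, 14, 6]), (219, ![3, 7, 5, 6, 14]), (220, ![3, 7, 5, 14, 6]),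
   (221, ![3, 7, 13, 6, 6]), (222, ![7, 3, 5, 6, 14]), (223, ![7, 3, 5, 14, 6]),
   (224, ![7, 3, 13, 6, 6]), (225, ![7, 11, 5, 6, 6])]

/-- The monomial `a_t = a_{35,t}`, `161 ≤ t ≤ 225` (the value at other `t` is irrelevant). -/
noncomputable def a (t : ℕ) : Fin 5 →₀ ℕ :=
  Finsupp.equivFunOnFinite.symm ((aTable.lookup t).getD 0)

end Data

end HitProblem

/-!
We compute modulo hit polynomials and monomials of smaller weight. If `n < 2ˢ`, then
`Sqⁿ (f * g ^ 2 ^ s) = Sqⁿ f * g ^ 2 ^ s`, so a relation between monomials coming from such squares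
only involves the exponents modulo `2ˢ`, and it persists when the monomials are multiplied by a
`2ˢ`-th power. Building exponents up digit by digit, finitely many such relations (up to
permutations of the variables) show that every monomial of weight `ω` outside the given list is
inadmissible.

For linear independence, we dualize. A functional on `P_5` which vanishes on hit polynomials is one
which is annihilated by the transposes of the squares `Sqⁿ`. In each case an explicit functional
takes the value `1` on one monomial of the list and `0` on all others. Substitutions map
such functionals to each other, and the translates of this one span the whole dual space. Here the
matrices of generators of `GL_5` are found by reducing the images of the monomials with the
relations above. The same matrices show that one class generates the module.
-/

namespace HitProblem

section SteenrodSquares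

variable {k : ℕ}

theorem totalSq_X (i : Fin k) :
    totalSq k (X i) = Polynomial.C (X i) + Polynomial.C (X i ^ 2) * Polynomial.X := by
  rw [totalSq, aeval_X]

theorem sq_apply (n : ℕ) (f : P k) : sq k n f = (totalSq k f).coeff n := rfl

theorem sq_one (n : ℕ) : sq k n 1 = if n = 0 then 1 else 0 := by
  rw [sq_apply, map_one, Polynomial.coeff_one]

theorem sq_mul (n : ℕ) (f g : P k) :
    sq k n (f * g) = ∑ a ∈ Finset.range (n + 1), sq k a f * sq k (n - a) g := by
  simp only [sq_apply, map_mul, Polynomial.coeff_mul,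
    Finset.Nat.sum_antidiagonal_eq_sum_range_succ_mk]

theorem sq_zero (f : P k) : sq k 0 f = f := by
  have h : ((Polynomial.aeval (0 : P k)).restrictScalars (ZMod 2)).comp (totalSq k)
      = AlgHom.id (ZMod 2) (P k) := by
    apply MvPolynomial.algHom_ext
    intro i
    simp [totalSq_X]
  simpa [Polynomial.coeff_zero_eq_aeval_zero, sq_apply] using DFunLike.congr_fun h f

theorem sq_X_pow (n : ℕ) (i : Fin k) (e : ℕ) :
    sq k n (X i ^ e) = (e.choose n : P k) * X i ^ (e + n) := by
  have key : totalSq k (X i ^ e) = ∑ a ∈ Finset.range (e + 1),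
      Polynomial.X ^ a * Polynomial.C ((e.choose a : P k) * X i ^ (e + a)) := by
    rw [map_pow, totalSq_X, add_comm, add_pow]
    refine Finset.sum_congr rfl fun a ha => ?_
    have h : (X i : P k) ^ (e + a) = (X i ^ 2) ^ a * X i ^ (e - a) := by
      rw [← pow_mul, ← pow_add]
      congr 1
      have := Finset.mem_range.1 ha
      omega
    rw [mul_pow, h]
    simp only [map_mul, map_pow, map_natCast]
    ring
  rw [sq_apply, key, Polynomial.finsetSum_coeff]
  simp only [Polynomial.coeff_mul_C, Polynomial.coeff_X_pow, ite_mul, one_mul, zero_mul,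
    Finset.sum_ite_eq, Finset.mem_range]
  split_ifs with h
  · rfl
  · rw [Nat.choose_eq_zero_of_lt (by omega), Nat.cast_zero, zero_mul]

theorem sq_pow_two_pow {s n : ℕ} (hn : n < 2 ^ s) (f : P k) :
    sq k n (f ^ 2 ^ s) = if n = 0 then f ^ 2 ^ s else 0 := by
  rw [sq_apply, map_pow, ← Polynomial.map_iterateFrobenius_expand, Polynomial.coeff_map,
    Polynomial.coeff_expand (by positivity)]
  rcases Nat.eq_zero_or_pos n with rfl | h0
  · simp [iterateFrobenius_def, ← sq_apply, sq_zero]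
  · rw [if_neg fun h => (Nat.le_of_dvd h0 h).not_gt hn, if_neg h0.ne', map_zero]

theorem sq_mul_pow_two_pow {s n : ℕ} (hn : n < 2 ^ s) (f g : P k) :
    sq k n (f * g ^ 2 ^ s) = sq k n f * g ^ 2 ^ s := by
  rw [sq_mul, Finset.sum_eq_single n]
  · rw [Nat.sub_self, sq_zero]
  · intro a ha hne
    have := Finset.mem_range.1 ha
    rw [sq_pow_two_pow (by omega), if_neg (by omega), mul_zero]
  · simp

theorem sq_mem_hit {n : ℕ} (hn : 1 ≤ n) (f : P k) : sq k n f ∈ hit k :=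
  (le_iSup₂ (f := fun n (_ : n ≥ 1) => LinearMap.range (sq k n)) n hn) ⟨_, rfl⟩

theorem hit_le {N : Submodule (ZMod 2) (P k)} (h : ∀ n ≥ 1, ∀ y, sq k n (mono y) ∈ N) :
    hit k ≤ N := by
  refine iSup₂_le fun n hn => ?_
  rintro _ ⟨f, rfl⟩
  rw [f.as_sum, map_sum]
  refine Submodule.sum_mem _ fun y _ => ?_
  rw [← mul_one (coeff y f), ← smul_eq_mul, ← smul_monomial, map_smul]
  exact N.smul_mem _ (h n hn y)

end SteenrodSquares

section OddBinomials

theorem land_eq_right_iff (a b : ℕ) :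
    a &&& b = b ↔ b % 2 ≤ a % 2 ∧ a / 2 &&& b / 2 = b / 2 := by
  have hdiv : (a &&& b) / 2 = a / 2 &&& b / 2 := Nat.and_div_two
  have hmod := Nat.and_mod_two_eq_one (a := a) (b := b)
  rw [← hdiv]
  omega

theorem choose_cast_zmod_two (a b : ℕ) : (a.choose b : ZMod 2) = if a &&& b = b then 1 else 0 := by
  induction a using Nat.strong_induction_on generalizing b with
  | _ a ih =>
    rcases Nat.eq_zero_or_pos a with rfl | ha
    · rcases b with _ | b <;> simp
    · have lucas := (ZMod.natCast_eq_natCast_iff _ _ _).2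
        (Choose.choose_modEq_choose_mod_mul_choose_div_nat (n := a) (k := b) (p := 2))
      rw [lucas, Nat.cast_mul, ih (a / 2) (by omega)]
      simp only [land_eq_right_iff a b]
      have hb := Nat.mod_lt b two_pos
      have ha := Nat.mod_lt a two_pos
      interval_cases b % 2 <;> interval_cases a % 2 <;> simp

end OddBinomials

section ListPolynomials

variable {k : ℕ}

/-- The exponent vector with the given entries. Monomials in computations are lists of exponents;
the results below concern lists of length `k`. -/
noncomputable def ofList (k : ℕ) (l : List ℕ) : Fin k →₀ ℕ :=
  Finsupp.equivFunOnFinite.symm fun j => l.getD j 0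

/-- The sum of the monomials with the given exponents, with repetitions. -/
noncomputable def polyOf (k : ℕ) (L : List (List ℕ)) : P k := (L.map fun l => mono (ofList k l)).sum

theorem ofList_apply (l : List ℕ) (j : Fin k) : ofList k l j = l.getD j 0 := rfl

theorem ofList_ofFn (v : Fin k → ℕ) :
    ofList k (List.ofFn v) = Finsupp.equivFunOnFinite.symm v := by
  ext j
  simp [ofList_apply]

theorem exists_eq_ofList (v : Fin k →₀ ℕ) : ∃ l : List ℕ, l.length = k ∧ ofList k l = v :=
  ⟨List.ofFn v, List.length_ofFn,
    (ofList_ofFn _).trans (Finsupp.equivFunOnFinite.symm_apply_apply v)⟩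

theorem map_finRange_ofList {l : List ℕ} (hl : l.length = k) :
    (List.finRange k).map (ofList k l) = l := by
  subst hl
  refine List.ext_getElem (by simp) fun i hi hi' => ?_
  simp [ofList_apply, hi']

theorem ofList_inj {l m : List ℕ} (hl : l.length = k) (hm : m.length = k) :
    ofList k l = ofList k m ↔ l = m := by
  refine ⟨fun h => ?_, congrArg _⟩
  rw [← map_finRange_ofList hl, ← map_finRange_ofList hm, h]

theorem sum_map_ofList {M : Type*} [AddCommMonoid M] {l : List ℕ} (hl : l.length = k)
    (g : ℕ → M) : ∑ j, g (ofList k l j) = (l.map g).sum := by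
  rw [← List.sum_ofFn, List.ofFn_eq_map]
  conv_rhs => rw [← map_finRange_ofList hl, List.map_map]
  rfl

theorem degree_ofList {l : List ℕ} (hl : l.length = k) : (ofList k l).degree = l.sum := by
  rw [Finsupp.degree_eq_sum, sum_map_ofList hl fun a => a, List.map_id']

theorem polyOf_nil : polyOf k [] = 0 := rfl

theorem polyOf_cons (l : List ℕ) (L : List (List ℕ)) :
    polyOf k (l :: L) = mono (ofList k l) + polyOf k L := by
  rw [polyOf, List.map_cons, List.sum_cons, polyOf]

theorem polyOf_append (L M : List (List ℕ)) : polyOf k (L ++ M) = polyOf k L + polyOf k M := by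
  rw [polyOf, List.map_append, List.sum_append, polyOf, polyOf]

theorem polyOf_mem {N : Submodule (ZMod 2) (P k)} {L : List (List ℕ)}
    (h : ∀ l ∈ L, mono (ofList k l) ∈ N) : polyOf k L ∈ N :=
  list_sum_mem (by simpa using h)

theorem map_polyOf {M : Type*} [AddCommMonoid M] [Module (ZMod 2) M] (φ : P k →ₗ[ZMod 2] M)
    (L : List (List ℕ)) : φ (polyOf k L) = (L.map fun l => φ (mono (ofList k l))).sum := by
  rw [polyOf, map_list_sum, List.map_map]
  rfl

theorem coeff_polyOf {L : List (List ℕ)} (hL : ∀ m ∈ L, m.length = k) {l : List ℕ}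
    (hl : l.length = k) : coeff (ofList k l) (polyOf k L) = (L.count l : ZMod 2) := by
  induction L with
  | nil => simp [polyOf_nil]
  | cons m L ih =>
    rw [List.forall_mem_cons] at hL
    rw [polyOf_cons, coeff_add, ih hL.2, coeff_monomial, List.count_cons, Nat.cast_add, add_comm]
    simp only [ofList_inj hL.1 hl, beq_iff_eq, Nat.cast_ite, Nat.cast_one, Nat.cast_zero]

end ListPolynomials

section Cancellation

variable {k : ℕ}

/-- The left lexicographical order on lists of the same length. -/
def lexLt : List ℕ → List ℕ → Bool
  | a :: l, b :: m => a < b || (a == b && lexLt l m)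
  | _, _ => false

/-- The sum of the monomial `x` and a sum of monomials over `𝔽₂`, where equal terms cancel.
Applied to strictly decreasing lists, it returns strictly decreasing lists. -/
def toggle (x : List ℕ) : List (List ℕ) → List (List ℕ)
  | [] => [x]
  | y :: L => if x == y then L else if lexLt y x then x :: y :: L else y :: toggle x L

/-- The sum of two sums of monomials over `𝔽₂`, where equal terms cancel. -/
def addTerms (L M : List (List ℕ)) : List (List ℕ) := L.foldr toggle M

theorem mem_of_mem_toggle {x y : List ℕ} {L : List (List ℕ)} (h : y ∈ toggle x L) :
    y = x ∨ y ∈ L := by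
  induction L with
  | nil => simpa [toggle] using h
  | cons z L ih =>
    rw [toggle] at h
    split_ifs at h <;> grind

theorem mem_of_mem_addTerms {y : List ℕ} {L M : List (List ℕ)} (h : y ∈ addTerms L M) :
    y ∈ L ∨ y ∈ M := by
  induction L with
  | nil => exact Or.inr h
  | cons x L ih =>
    rcases mem_of_mem_toggle h with rfl | h
    · exact Or.inl List.mem_cons_self
    · exact (ih h).imp_left (List.mem_cons_of_mem x)

theorem polyOf_toggle (x : List ℕ) (L : List (List ℕ)) :
    polyOf k (toggle x L) = mono (ofList k x) + polyOf k L := by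
  induction L with
  | nil => rfl
  | cons y L ih =>
    rw [toggle]
    split_ifs with hxy
    · rw [← eq_of_beq hxy, polyOf_cons, ← add_assoc, CharTwo.add_self_eq_zero, zero_add]
    · rfl
    · rw [polyOf_cons, ih, polyOf_cons, add_left_comm]

theorem polyOf_addTerms (L M : List (List ℕ)) :
    polyOf k (addTerms L M) = polyOf k L + polyOf k M := by
  induction L with
  | nil => rw [polyOf_nil, zero_add]; rfl
  | cons x L ih => rw [addTerms, List.foldr_cons, polyOf_toggle, ← addTerms, ih, polyOf_cons,
      add_assoc]

end Cancellation

section SquaresOfMonomials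

variable {k : ℕ}

/-- The terms of the square `Sqⁿ` of the monomial with the given exponents. -/
def sqList : List ℕ → ℕ → List (List ℕ)
  | [], 0 => [[]]
  | [], _ + 1 => []
  | a :: l, n => ((List.range (n + 1)).filter fun b => a &&& b = b).flatMap fun b =>
      (sqList l (n - b)).map ((a + b) :: ·)

/-- The monomials `x` such that the monomial with the given exponents is a term of `Sqⁿ x`. -/
def dualSqList : List ℕ → ℕ → List (List ℕ)
  | [], 0 => [[]]
  | [], _ + 1 => []
  | c :: l, n => ((List.range (n + 1)).filter fun b => b ≤ c ∧ (c - b) &&& b = b).flatMap fun b =>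
      (dualSqList l (n - b)).map ((c - b) :: ·)

theorem length_and_sum_of_mem_sqList {l m : List ℕ} {n : ℕ} (h : m ∈ sqList l n) :
    m.length = l.length ∧ m.sum = l.sum + n := by
  induction l generalizing n m with
  | nil =>
    cases n with
    | zero => simp_all [sqList]
    | succ n => simp [sqList] at h
  | cons a l ih =>
    simp only [sqList, List.mem_flatMap, List.mem_filter, List.mem_range, List.mem_map] at h
    obtain ⟨b, ⟨hb, -⟩, m, hm, rfl⟩ := h
    obtain ⟨h1, h2⟩ := ih hm
    simp only [List.length_cons, List.sum_cons]
    omega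

theorem length_of_mem_dualSqList {l m : List ℕ} {n : ℕ} (h : m ∈ dualSqList l n) :
    m.length = l.length := by
  induction l generalizing n m with
  | nil => cases n <;> simp_all [dualSqList]
  | cons a l ih =>
    simp only [dualSqList, List.mem_flatMap, List.mem_map] at h
    obtain ⟨b, -, m, hm, rfl⟩ := h
    rw [List.length_cons, List.length_cons, ih hm]

theorem sum_map_filter {α M : Type*} [AddCommMonoid M] (L : List α) (p : α → Bool) (g : α → M) :
    ((L.filter p).map g).sum = (L.map fun b => if p b then g b else 0).sum := by
  rw [List.sum_map_ite]
  simp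

theorem sum_map_flatMap_filter {α β M : Type*} [AddCommMonoid M] (L : List α) (p : α → Bool)
    (F : α → List β) (g : β → M) : (((L.filter p).flatMap F).map g).sum
      = (L.map fun b => if p b then ((F b).map g).sum else 0).sum := by
  rw [← sum_map_filter, List.map_flatMap, List.flatMap, List.sum_flatten, List.map_map]
  rfl

theorem count_map_cons (a b : ℕ) (l : List ℕ) (L : List (List ℕ)) :
    (L.map (a :: ·)).count (b :: l) = if a = b then L.count l else 0 := by
  split_ifs with h
  · rw [h, List.count_map_of_injective _ _ List.cons_injective]
  · exact List.count_eq_zero.2 (by simp [h])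

theorem count_flatMap_filter_map_cons (L : List ℕ) (p : ℕ → Bool) (g : ℕ → ℕ)
    (F : ℕ → List (List ℕ)) (c : ℕ) (l : List ℕ) :
    ((L.filter p).flatMap fun b => (F b).map (g b :: ·)).count (c :: l)
      = (L.map fun b => if p b ∧ g b = c then (F b).count l else 0).sum := by
  induction L with
  | nil => rfl
  | cons b L ih =>
    rw [List.filter_cons]
    split_ifs with h <;> simp [h, ih, count_map_cons]

theorem count_dualSqList (c l : List ℕ) (n : ℕ) :
    (dualSqList c n).count l = (sqList l n).count c := by
  induction c generalizing l n with
  | nil =>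
    cases l with
    | nil => cases n <;> rfl
    | cons a l =>
      rw [List.count_eq_zero.2, List.count_eq_zero.2]
      · exact fun h => by simpa using (length_and_sum_of_mem_sqList h).1
      · exact fun h => by simpa using length_of_mem_dualSqList h
  | cons b c ih =>
    cases l with
    | nil =>
      rw [List.count_eq_zero.2, List.count_eq_zero.2]
      · exact fun h => by simpa using (length_and_sum_of_mem_sqList h).1
      · exact fun h => by simpa using length_of_mem_dualSqList h
    | cons a l =>
      rw [dualSqList, sqList, count_flatMap_filter_map_cons, count_flatMap_filter_map_cons]
      congr 1
      refine List.map_congr_left fun d _ => ?_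
      rw [ih]
      refine if_congr ?_ rfl rfl
      simp only [decide_eq_true_eq]
      constructor
      · rintro ⟨⟨h, h'⟩, rfl⟩
        exact ⟨h', Nat.sub_add_cancel h⟩
      · rintro ⟨h, rfl⟩
        rw [Nat.add_sub_cancel]
        exact ⟨⟨Nat.le_add_left d a, h⟩, rfl⟩

theorem mono_eq_prod (v : Fin k →₀ ℕ) : (mono v : P k) = ∏ i, X i ^ v i := by
  rw [mono, monomial_eq, C_1, one_mul, Finsupp.prod_fintype _ _ fun i => pow_zero _]

theorem mono_ofList {l : List ℕ} (hl : l.length = k) :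
    mono (ofList k l) = (List.zipWith (fun i a => (X i : P k) ^ a) (List.finRange k) l).prod := by
  rw [mono_eq_prod, ← List.prod_ofFn]
  subst hl
  refine congrArg List.prod (List.ext_getElem (by simp) fun i hi hi' => ?_)
  simp [ofList_apply]

theorem sq_prod_X_pow (n : ℕ) {vars : List (Fin k)} {l : List ℕ} (h : l.length = vars.length) :
    sq k n (List.zipWith (fun i a => (X i : P k) ^ a) vars l).prod =
      ((sqList l n).map fun m => (List.zipWith (fun i a => (X i : P k) ^ a) vars m).prod).sum := by
  induction vars generalizing n l with
  | nil =>
    obtain rfl := List.eq_nil_of_length_eq_zero h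
    cases n <;> simp [sqList, sq_one]
  | cons i vars ih =>
    obtain ⟨a, l, rfl⟩ := List.exists_cons_of_length_eq_add_one h
    rw [sqList, sum_map_flatMap_filter, List.zipWith_cons_cons, List.prod_cons, sq_mul]
    change _ = ∑ b ∈ Finset.range (n + 1), _
    refine Finset.sum_congr rfl fun b _ => ?_
    rw [ih _ (Nat.succ.inj h), sq_X_pow, ← map_natCast (C : ZMod 2 →+* P k), choose_cast_zmod_two]
    simp only [decide_eq_true_eq, List.map_map]
    split_ifs with hb
    · rw [C_1, one_mul, ← List.sum_map_mul_left]
      simp [Function.comp_def]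
    · simp

theorem sq_mono_ofList (n : ℕ) {l : List ℕ} (hl : l.length = k) :
    sq k n (mono (ofList k l)) = polyOf k (sqList l n) := by
  rw [mono_ofList hl, sq_prod_X_pow n (by rw [hl, List.length_finRange]), polyOf]
  refine congrArg List.sum (List.map_congr_left fun m hm => (mono_ofList ?_).symm)
  rw [(length_and_sum_of_mem_sqList hm).1, hl]

end SquaresOfMonomials

section Negligible

variable {k : ℕ} {ω : ℕ →₀ ℕ}

/-- The span of all monomials of weight smaller than `ω`, in any degree. -/
noncomputable def lowWeight (k : ℕ) (ω : ℕ →₀ ℕ) : Submodule (ZMod 2) (P k) :=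
  restrictSupport (ZMod 2) {y | toLex (weight y) < toLex ω}

/-- The polynomials that vanish modulo hit polynomials and monomials of weight smaller than `ω`.
On `P_k(ω)` this is the denominator of `QP_k(ω)`, see `relations_eq_submoduleOf`. -/
noncomputable def negligible (k : ℕ) (ω : ℕ →₀ ℕ) : Submodule (ZMod 2) (P k) :=
  hit k ⊔ lowWeight k ω

theorem hit_le_negligible : hit k ≤ negligible k ω := le_sup_left

theorem mono_mem_negligible {y : Fin k →₀ ℕ} (h : toLex (weight y) < toLex ω) :
    mono y ∈ negligible k ω :=
  Submodule.mem_sup_right ((monomial_mem_restrictSupport _).2 (.inl h))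

theorem subst_mem_negligible (A : Matrix (Fin k) (Fin k) (ZMod 2)) {f : P k}
    (hf : f ∈ negligible k ω) : subst A f ∈ negligible k ω := by
  suffices h : negligible k ω ≤ (negligible k ω).comap (subst A).toLinearMap from h hf
  rw [negligible, lowWeight, restrictSupport_eq_span]
  refine sup_le (fun g hg => Submodule.mem_sup_left (subst_mem_hit A hg)) (Submodule.span_le.2 ?_)
  rintro _ ⟨x, hx, rfl⟩
  rw [← restrictSupport_eq_span]
  exact Submodule.mem_sup_right ((mem_restrictSupport_iff _).2 fun y hy =>
    (subst_mono_support' A x y hy).2.trans_lt hx)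

/-- The polynomials which remain negligible after multiplication by a `2ˢ`-th power. The
computations below take place modulo this subspace, so that relations between the residues of the
exponents modulo `2ˢ` apply to all monomials with these residues. -/
noncomputable def stablyNegligible (k : ℕ) (ω : ℕ →₀ ℕ) (s : ℕ) : Submodule (ZMod 2) (P k) :=
  ⨅ p : P k, (negligible k ω).comap (LinearMap.mulRight (ZMod 2) (p ^ 2 ^ s))

variable {s : ℕ} {f : P k}

theorem mem_stablyNegligible :
    f ∈ stablyNegligible k ω s ↔ ∀ p : P k, f * p ^ 2 ^ s ∈ negligible k ω := by
  simp [stablyNegligible]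

theorem stablyNegligible_le_negligible : stablyNegligible k ω s ≤ negligible k ω := fun f hf => by
  simpa using mem_stablyNegligible.1 hf 1

theorem mul_pow_mem_stablyNegligible (hf : f ∈ stablyNegligible k ω s) (p : P k) :
    f * p ^ 2 ^ s ∈ stablyNegligible k ω s :=
  mem_stablyNegligible.2 fun q => by
    rw [mul_assoc, ← mul_pow]
    exact mem_stablyNegligible.1 hf _

theorem stablyNegligible_mono {t : ℕ} (h : s ≤ t) :
    stablyNegligible k ω s ≤ stablyNegligible k ω t := fun f hf => by
  refine mem_stablyNegligible.2 fun p => ?_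
  rw [← Nat.sub_add_cancel h, pow_add, pow_mul]
  exact mem_stablyNegligible.1 hf _

theorem subst_mem_stablyNegligible (g : GL (Fin k) (ZMod 2)) (hf : f ∈ stablyNegligible k ω s) :
    subst g.1 f ∈ stablyNegligible k ω s := by
  refine mem_stablyNegligible.2 fun p => ?_
  have hp : subst g.1 (subst (g⁻¹).1 p) = p := by
    rw [← AlgHom.comp_apply, ← subst_mul, ← Units.val_mul, mul_inv_cancel, Units.val_one, subst_one]
    rfl
  rw [← hp, ← map_pow, ← map_mul]
  exact subst_mem_negligible _ (mem_stablyNegligible.1 hf _)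

theorem sq_mem_stablyNegligible {n : ℕ} (hn : 1 ≤ n) (hns : n < 2 ^ s) (f : P k) :
    sq k n f ∈ stablyNegligible k ω s := by
  refine mem_stablyNegligible.2 fun p => ?_
  rw [← sq_mul_pow_two_pow hns]
  exact hit_le_negligible (sq_mem_hit hn _)

theorem mono_pow (y : Fin k →₀ ℕ) (n : ℕ) : (mono y : P k) ^ n = mono (n • y) := by
  rw [mono, monomial_pow, one_pow]

theorem mono_mul (x y : Fin k →₀ ℕ) : (mono x : P k) * mono y = mono (x + y) := by
  rw [mono, mono, monomial_mul, one_mul]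

theorem div_two_pow_add_mod_two {i s : ℕ} (h : i < s) (a b : ℕ) :
    (a + 2 ^ s * b) / 2 ^ i % 2 = a / 2 ^ i % 2 := by
  obtain ⟨d, rfl⟩ := Nat.exists_eq_add_of_lt h
  rw [show 2 ^ (i + d + 1) * b = 2 ^ i * (2 * (2 ^ d * b)) by ring,
    Nat.add_mul_div_left _ _ (by positivity), Nat.add_mul_mod_self_left]

theorem weight_add_two_pow_smul {i : ℕ} (h : i < s) (x y : Fin k →₀ ℕ) :
    weight (x + 2 ^ s • y) i = weight x i := by
  simp only [weight_apply, Finsupp.add_apply, Finsupp.smul_apply, smul_eq_mul,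
    div_two_pow_add_mod_two h]

theorem mono_mem_stablyNegligible {x : Fin k →₀ ℕ} {i : ℕ} (hi : i < s)
    (heq : ∀ j < i, weight x j = ω j) (hlt : weight x i < ω i) :
    mono x ∈ stablyNegligible k ω s := by
  refine mem_stablyNegligible.2 fun p => ?_
  rw [p.as_sum, sum_pow_char_pow, Finset.mul_sum]
  refine Submodule.sum_mem _ fun y _ => ?_
  have hterm : mono x * monomial y (coeff y p) ^ 2 ^ s
      = coeff y p ^ 2 ^ s • mono (x + 2 ^ s • y) := by
    rw [monomial_pow, monomial_mul, one_mul, smul_monomial, smul_eq_mul, mul_one]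
  rw [hterm]
  refine Submodule.smul_mem _ _ (mono_mem_negligible (Finsupp.Lex.lt_iff.2 ⟨i, fun j hj => ?_, ?_⟩))
  · exact (weight_add_two_pow_smul (hj.trans hi) x y).trans (heq j hj)
  · exact (weight_add_two_pow_smul hi x y).trans_lt hlt

end Negligible

section WeightsOfLists

variable {k : ℕ} {ω : ℕ →₀ ℕ} {w x : List ℕ}

/-- The first `n` entries of the weight vector. -/
def digitSums (n : ℕ) (x : List ℕ) : List ℕ :=
  (List.range n).map fun i => (x.map (· / 2 ^ i % 2)).sum

/-- The weight vector of `x` starts with entries lexicographically smaller than `w`. -/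
def isLower (w x : List ℕ) : Bool := lexLt (digitSums w.length x) w

/-- The weight vector of `x` is `w`, followed by zeros. -/
def hasWeight (w x : List ℕ) : Bool := digitSums w.length x == w && x.all (· < 2 ^ w.length)

theorem exists_lt_of_lexLt {l m : List ℕ} (h : lexLt l m) : ∃ i < l.length, i < m.length ∧
    (∀ j < i, l.getD j 0 = m.getD j 0) ∧ l.getD i 0 < m.getD i 0 := by
  induction l generalizing m with
  | nil => simp [lexLt] at h
  | cons a l ih =>
    cases m with
    | nil => simp [lexLt] at h
    | cons b m =>
      simp only [lexLt, Bool.or_eq_true, Bool.and_eq_true, decide_eq_true_eq, beq_iff_eq] at h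
      rcases h with h | ⟨rfl, h⟩
      · exact ⟨0, by simp, by simp, by simp, h⟩
      · obtain ⟨i, hl, hm, heq, hlt⟩ := ih h
        refine ⟨i + 1, by simpa using hl, by simpa using hm, fun j hj => ?_, by simpa using hlt⟩
        cases j with
        | zero => rfl
        | succ j => simpa using heq j (by omega)

theorem lexLt_of_lt {l m : List ℕ} {i : ℕ} (hl : i < l.length) (hm : i < m.length)
    (heq : ∀ j < i, l.getD j 0 = m.getD j 0) (hlt : l.getD i 0 < m.getD i 0) : lexLt l m := by
  induction i generalizing l m with
  | zero => cases l <;> cases m <;> simp_all [lexLt]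
  | succ i ih =>
    cases l with
    | nil => simp at hl
    | cons a l =>
      cases m with
      | nil => simp at hm
      | cons b m =>
        have htail := ih (by simpa using hl) (by simpa using hm)
          (fun j hj => by simpa using heq (j + 1) (by omega)) (by simpa using hlt)
        have hhead : a = b := heq 0 (by omega)
        simp [lexLt, hhead, htail]

theorem toLex_ofList_lt {l m : List ℕ} (hl : l.length = k) (h : lexLt l m) :
    toLex (ofList k l) < toLex (ofList k m) := by
  obtain ⟨i, hi, -, heq, hlt⟩ := exists_lt_of_lexLt h
  exact Finsupp.Lex.lt_iff.2 ⟨⟨i, hl ▸ hi⟩, fun j hj => heq j hj, hlt⟩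

theorem weight_ofList (hx : x.length = k) (i : ℕ) :
    weight (ofList k x) i = (x.map (· / 2 ^ i % 2)).sum := by
  rw [weight_apply, sum_map_ofList hx fun a => a / 2 ^ i % 2]

theorem getD_digitSums {n i : ℕ} (hi : i < n) (hx : x.length = k) :
    (digitSums n x).getD i 0 = weight (ofList k x) i := by
  rw [weight_ofList hx]
  simp [digitSums, hi]

theorem mono_ofList_mem_of_isLower {s : ℕ} (hx : x.length = k) (hw : w.length ≤ s)
    (hω : ∀ i < w.length, ω i = w.getD i 0) (h : isLower w x) :
    mono (ofList k x) ∈ stablyNegligible k ω s := by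
  obtain ⟨i, -, hi, heq, hlt⟩ := exists_lt_of_lexLt h
  refine mono_mem_stablyNegligible (hi.trans_le hw) (fun j hj => ?_) ?_
  · rw [hω j (hj.trans hi), ← heq j hj, getD_digitSums (hj.trans hi) hx]
  · rwa [hω i hi, ← getD_digitSums hi hx]

theorem weight_ofList_of_hasWeight (hx : x.length = k) (hω : ω = w.toFinsupp)
    (h : hasWeight w x) : weight (ofList k x) = ω := by
  rw [hasWeight, Bool.and_eq_true, beq_iff_eq, List.all_eq_true] at h
  ext i
  rw [hω, List.toFinsupp_apply]
  rcases lt_or_ge i w.length with hi | hi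
  · rw [← getD_digitSums hi hx, h.1]
  · rw [weight_ofList hx, List.getD_eq_default _ _ hi]
    refine List.sum_eq_zero fun b hb => ?_
    obtain ⟨a, ha, rfl⟩ := List.mem_map.1 hb
    have ha := of_decide_eq_true (h.2 a ha)
    rw [Nat.div_eq_of_lt (ha.trans_le (Nat.pow_le_pow_right two_pos hi)), Nat.zero_mod]

end WeightsOfLists

section Substitutions

/-- The map `F` describes, on monomials, a linear substitution of the `k` variables. -/
def IsSubstitution (k : ℕ) (F : List ℕ → List (List ℕ)) : Prop :=
  ∃ g : GL (Fin k) (ZMod 2), ∀ x : List ℕ, x.length = k →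
    (∀ y ∈ F x, y.length = k) ∧ subst g.1 (mono (ofList k x)) = polyOf k (F x)

/-- The rearrangement of the entries of `x` by a permutation `p` of `0, …, k - 1`. -/
def permute (p x : List ℕ) : List ℕ := p.map fun i => x.getD i 0

/-- The monomials in the image of a monomial under the substitution `x₁ ↦ x₁ + x₂`. -/
def transvect : List ℕ → List (List ℕ)
  | a :: b :: l => ((List.range (a + 1)).filter fun i => a &&& i = i).map
      fun i => (a - i) :: (b + i) :: l
  | _ => []

theorem subst_permMatrix {k : ℕ} (σ : Equiv.Perm (Fin k)) :
    subst (σ.permMatrix (ZMod 2)) = rename σ.symm := by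
  refine MvPolynomial.algHom_ext fun i => ?_
  rw [subst, aeval_X, rename_X, Finset.sum_eq_single (σ.symm i)]
  · simp [Equiv.Perm.permMatrix, PEquiv.toMatrix_apply]
  · intro j _ hj
    have : σ j ≠ i := fun h => hj (by rw [← h, Equiv.symm_apply_apply])
    simp [Equiv.Perm.permMatrix, PEquiv.toMatrix_apply, this]
  · simp

theorem exists_permute_eq_mapDomain {k : ℕ} {p : List ℕ} (hp : p.Perm (List.range k)) :
    ∃ σ : Equiv.Perm (Fin k), ∀ x : List ℕ,
      ofList k (permute p x) = (ofList k x).mapDomain σ.symm := by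
  have hlen : p.length = k := by rw [hp.length_eq, List.length_range]
  have hlt (j : Fin k) : p[j] < k := List.mem_range.1 (hp.subset (List.getElem_mem _))
  have hinj : Function.Injective fun j : Fin k => (⟨p[j], hlt j⟩ : Fin k) := fun i j hij => by
    have := (hp.nodup_iff.2 List.nodup_range).getElem_inj_iff.1 (Fin.mk.inj hij)
    exact Fin.ext this
  refine ⟨Equiv.ofBijective _ (Finite.injective_iff_bijective.1 hinj), fun x => ?_⟩
  ext j
  rw [Finsupp.mapDomain_equiv_apply, Equiv.symm_symm, Equiv.ofBijective_apply]
  simp [ofList_apply, permute, hlen]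

theorem isSubstitution_permute {k : ℕ} {p : List ℕ} (hp : p.Perm (List.range k)) :
    IsSubstitution k fun x => [permute p x] := by
  obtain ⟨σ, hσ⟩ := exists_permute_eq_mapDomain hp
  have hdet : (σ.permMatrix (ZMod 2)).det ≠ 0 := by
    rw [Matrix.det_permutation]
    exact ((Equiv.Perm.sign σ).isUnit.map (Int.castRingHom (ZMod 2))).ne_zero
  refine ⟨.mkOfDetNeZero _ hdet, fun x _ => ⟨?_, ?_⟩⟩
  · simp [permute, hp.length_eq]
  · change subst (σ.permMatrix (ZMod 2)) _ = _
    rw [subst_permMatrix, mono, rename_monomial, ← hσ, polyOf_cons, polyOf_nil, add_zero]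

theorem ofList_cons_cons {n : ℕ} (a b : ℕ) (l : List ℕ) : ofList (n + 2) (a :: b :: l) =
    Finsupp.single 0 a + Finsupp.single 1 b + ofList (n + 2) (0 :: 0 :: l) := by
  ext j
  refine Fin.cases ?_ (Fin.cases ?_ fun j => ?_) j <;>
    simp [ofList_apply, Fin.ext_iff]

theorem mono_ofList_cons_cons {n : ℕ} (a b : ℕ) (l : List ℕ) : mono (ofList (n + 2) (a :: b :: l))
    = X 0 ^ a * X 1 ^ b * mono (ofList (n + 2) (0 :: 0 :: l)) := by
  rw [ofList_cons_cons, ← mono_mul, ← mono_mul, X_pow_eq_monomial, X_pow_eq_monomial]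

theorem subst_transvection_X {n : ℕ} (i : Fin (n + 2)) :
    subst (Matrix.transvection 1 0 (1 : ZMod 2)) (X i) = if i = 0 then X 0 + X 1 else X i := by
  simp only [subst, aeval_X, Matrix.transvection, Matrix.add_apply, Matrix.one_apply, map_add,
    add_mul, Finset.sum_add_distrib, Matrix.single_apply]
  split_ifs with h
  · subst h
    simp
  · simp [Ne.symm h]

theorem subst_transvection_mono {n : ℕ} {v : Fin (n + 2) →₀ ℕ} (hv : v 0 = 0) :
    subst (Matrix.transvection 1 0 (1 : ZMod 2)) (mono v) = mono v := by
  rw [mono_eq_prod, map_prod]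
  refine Finset.prod_congr rfl fun i _ => ?_
  rw [map_pow, subst_transvection_X]
  split_ifs with h
  · rw [h, hv, pow_zero, pow_zero]
  · rfl

theorem isSubstitution_transvect {n : ℕ} : IsSubstitution (n + 2) transvect := by
  have hdet : (Matrix.transvection (1 : Fin (n + 2)) 0 (1 : ZMod 2)).det ≠ 0 := by
    rw [Matrix.det_transvection_of_ne _ _ one_ne_zero]
    exact one_ne_zero
  refine ⟨.mkOfDetNeZero _ hdet, fun x hx => ?_⟩
  obtain ⟨a, x, rfl⟩ := List.exists_cons_of_length_eq_add_one hx
  obtain ⟨b, l, rfl⟩ := List.exists_cons_of_length_eq_add_one (Nat.succ.inj hx)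
  refine ⟨?_, ?_⟩
  · rintro y hy
    obtain ⟨i, -, rfl⟩ := List.mem_map.1 hy
    exact hx
  change subst (Matrix.transvection 1 0 1) _ = _
  rw [mono_ofList_cons_cons, map_mul, subst_transvection_mono rfl, map_mul, map_pow, map_pow,
    subst_transvection_X, subst_transvection_X, if_pos rfl, if_neg one_ne_zero, add_comm (X 0),
    add_pow, Finset.sum_mul, Finset.sum_mul, transvect, polyOf, List.map_map,
    sum_map_filter]
  change _ = ∑ i ∈ Finset.range (a + 1), _
  refine Finset.sum_congr rfl fun i _ => ?_
  rw [← map_natCast (C : ZMod 2 →+* P (n + 2)), choose_cast_zmod_two]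
  simp only [decide_eq_true_eq]
  split_ifs with h
  · rw [Function.comp_apply, mono_ofList_cons_cons (a - i), C_1]
    ring
  · rw [C_0, mul_zero, zero_mul, zero_mul]

end Substitutions

section Rewriting

/-- `f` rewrites monomials in `k` variables modulo `N`. The value `none` means that `f` does not
apply. -/
def IsReduction (k : ℕ) (N : Submodule (ZMod 2) (P k)) (f : List ℕ → Option (List (List ℕ))) :
    Prop :=
  ∀ x r, x.length = k → f x = some r →
    (∀ y ∈ r, y.length = k) ∧ mono (ofList k x) ≡ polyOf k r [SMOD N]

/-- A relation between the Steenrod squares `Sqⁿ x`, `(n, x) ∈ squares`, which is used to rewrite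
the monomials in `heads`, and their images under permutations of the variables. -/
structure Rule where
  heads : List (List ℕ)
  squares : List (ℕ × List ℕ)

/-- Rules which apply to monomials whose weight vector starts with `w`. -/
structure Stage where
  w : List ℕ
  rules : List Rule

/-- The continuation `f` applied to `x`. The kernel evaluates the entries of `x` first, instead of
copying them unevaluated to all places where `f` uses them. -/
def force {α : Type*} : List ℕ → (List ℕ → α) → α
  | [], f => f []
  | 0 :: x, f => force x fun y => f (0 :: y)
  | (a + 1) :: x, f => force x fun y => f ((a + 1) :: y)

/-- The lists `p` of positions with `m[p[i]] = x[i]` for all `i`, without repetitions. -/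
def matchings (m : List ℕ) : List ℕ → List ℕ → List (List ℕ)
  | _, [] => [[]]
  | positions, a :: x => (positions.filter fun j => m.getD j 0 == a).flatMap fun j =>
      (matchings m (positions.erase j) x).map (j :: ·)

/-- A number which depends only on the multiset of entries, and determines it if there are fewer
than `16` entries. -/
def signature (x : List ℕ) : ℕ := (x.map (16 ^ ·)).sum

/-- The sum of the given squares, without the terms of weight smaller than `w`. -/
def relation (w : List ℕ) (squares : List (ℕ × List ℕ)) : List (List ℕ) :=
  addTerms ((squares.flatMap fun q => sqList q.2 q.1).filter fun y => !isLower w y) []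

/-- The result of rewriting leading terms by `f` until they are smaller than `x`. -/
def descend (f : List ℕ → Option (List (List ℕ))) (x : List ℕ) :
    ℕ → List (List ℕ) → Option (List (List ℕ))
  | 0, _ => none
  | _ + 1, [] => some []
  | n + 1, y :: L => if lexLt y x then some (y :: L) else
      (force y f).bind fun r => descend f x n (addTerms r L)

/-- The reduction of a monomial to smaller ones by one of the rules and, subsequently, `f`. -/
def rewrite (f : List ℕ → Option (List (List ℕ))) (w : List ℕ) (rules : List Rule) (x : List ℕ) :
    Option (List (List ℕ)) :=
  rules.findSome? fun R => R.heads.findSome? fun h =>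
    if signature h != signature x then none else
    (matchings h (List.range x.length) x).findSome? fun p =>
      descend f x 30 (addTerms (x :: (relation w R.squares).map (permute p)) [])

/-- The exponents `xᵢ + 2ˢ bᵢ`. -/
def addDigits (s : ℕ) (x b : List ℕ) : List ℕ := List.zipWith (fun c d => c + 2 ^ s * d) x b

/-- The reduction `f` applied to the residues of the exponents modulo `2ˢ`. -/
def lift (s : ℕ) (f : List ℕ → Option (List (List ℕ))) (x : List ℕ) : Option (List (List ℕ)) :=
  (f (x.map (· % 2 ^ s))).map fun r => r.map fun y => addDigits s y (x.map (· / 2 ^ s))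

/-- The reduction by the rules of the last stage which applies. -/
def step : List Stage → List ℕ → Option (List (List ℕ))
  | [], _ => none
  | st :: rest, x => (step rest x).or (lift st.w.length (rewrite (step rest) st.w st.rules) x)

/-- The result of rewriting all terms by `f` as long as possible, in at most `n` steps. -/
def normalForm (f : List ℕ → Option (List (List ℕ))) : ℕ → List (List ℕ) → List (List ℕ)
  | 0, L => L
  | _ + 1, [] => []
  | n + 1, y :: L => match force y f with
    | some r => normalForm f n (addTerms r L)
    | none => y :: normalForm f n L

/-- The stages are ordered by decreasing length of their prefixes of `w`, and the rules for a prefix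
of length `s` involve squares `Sqⁿ`, `0 < n < 2ˢ`, of monomials in `k` variables only. -/
def IsValid (k : ℕ) (w : List ℕ) (st : List Stage) : Prop :=
  (st.Pairwise fun a b => b.w.length ≤ a.w.length) ∧ ∀ a ∈ st, a.w <+: w ∧
    ∀ R ∈ a.rules, ∀ q ∈ R.squares, 1 ≤ q.1 ∧ q.1 < 2 ^ a.w.length ∧ q.2.length = k

instance (k : ℕ) (w : List ℕ) (st : List Stage) : Decidable (IsValid k w st) := by
  unfold IsValid
  infer_instance

variable {k s : ℕ} {ω : ℕ →₀ ℕ} {N : Submodule (ZMod 2) (P k)} {x w : List ℕ}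
  {L r : List (List ℕ)} {f : List ℕ → Option (List (List ℕ))}

theorem force_eq {α : Type*} (x : List ℕ) (f : List ℕ → α) : force x f = f x := by
  induction x generalizing f with
  | nil => rfl
  | cons a x ih => cases a <;> exact ih _

theorem subperm_of_mem_matchings {m p x positions : List ℕ} (h : p ∈ matchings m positions x) :
    p.length = x.length ∧ p.Subperm positions := by
  induction x generalizing p positions with
  | nil => simp_all [matchings]
  | cons a x ih =>
    simp only [matchings, List.mem_flatMap, List.mem_filter, List.mem_map] at h
    obtain ⟨j, ⟨hj, -⟩, p, hp, rfl⟩ := h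
    obtain ⟨hlen, hsub⟩ := ih hp
    exact ⟨congrArg (· + 1) hlen,
      ((List.subperm_cons j).2 hsub).trans (List.perm_cons_erase hj).symm.subperm⟩

theorem perm_range_of_mem_matchings {m p x : List ℕ} (h : p ∈ matchings m (List.range x.length) x) :
    p.Perm (List.range x.length) := by
  obtain ⟨hlen, hsub⟩ := subperm_of_mem_matchings h
  exact hsub.perm_of_length_le (by rw [hlen, List.length_range])

theorem IsSubstitution.exists_subst_polyOf {F : List ℕ → List (List ℕ)} (hF : IsSubstitution k F) :
    ∃ g : GL (Fin k) (ZMod 2), ∀ L : List (List ℕ), (∀ x ∈ L, x.length = k) →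
      (∀ y ∈ L.flatMap F, y.length = k) ∧ subst g.1 (polyOf k L) = polyOf k (L.flatMap F) := by
  obtain ⟨g, hg⟩ := hF
  refine ⟨g, fun L hL => ⟨?_, ?_⟩⟩
  · simp only [List.mem_flatMap]
    rintro y ⟨x, hx, hy⟩
    exact (hg x (hL x hx)).1 y hy
  · induction L with
    | nil => exact map_zero _
    | cons x L ih =>
      rw [List.forall_mem_cons] at hL
      rw [polyOf_cons, map_add, (hg x hL.1).2, ih hL.2, List.flatMap_cons, polyOf_append]

theorem polyOf_map_permute_mem {p : List ℕ} (hp : p.Perm (List.range k))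
    (hL : ∀ x ∈ L, x.length = k) (h : polyOf k L ∈ stablyNegligible k ω s) :
    polyOf k (L.map (permute p)) ∈ stablyNegligible k ω s := by
  obtain ⟨g, hg⟩ := (isSubstitution_permute hp).exists_subst_polyOf
  have h' := subst_mem_stablyNegligible g h
  rwa [(hg L hL).2, ← List.map_eq_flatMap] at h'

theorem polyOf_smodEq_filter (hw : w.length ≤ s) (hω : ∀ i < w.length, ω i = w.getD i 0)
    (hL : ∀ x ∈ L, x.length = k) :
    polyOf k L ≡ polyOf k (L.filter fun y => !isLower w y) [SMOD stablyNegligible k ω s] := by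
  induction L with
  | nil => rfl
  | cons x L ih =>
    rw [List.forall_mem_cons] at hL
    rw [List.filter_cons]
    split_ifs with hx
    · exact SModEq.rfl.add (ih hL.2)
    · have hlow := mono_ofList_mem_of_isLower hL.1 hw hω (by simpa using hx)
      simpa [polyOf_cons] using (SModEq.zero.2 hlow).add (ih hL.2)

theorem length_of_mem_relation {squares : List (ℕ × List ℕ)} (hs : ∀ q ∈ squares, q.2.length = k) :
    ∀ y ∈ relation w squares, y.length = k := by
  intro y hy
  rcases mem_of_mem_addTerms hy with hy | hy
  · obtain ⟨q, hq, hy⟩ := List.mem_flatMap.1 (List.mem_of_mem_filter hy)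
    rw [(length_and_sum_of_mem_sqList hy).1, hs q hq]
  · simp at hy

theorem polyOf_relation_mem {squares : List (ℕ × List ℕ)} (hω : ∀ i < w.length, ω i = w.getD i 0)
    (hs : ∀ q ∈ squares, 1 ≤ q.1 ∧ q.1 < 2 ^ w.length ∧ q.2.length = k) :
    polyOf k (relation w squares) ∈ stablyNegligible k ω w.length := by
  rw [relation, polyOf_addTerms, polyOf_nil, add_zero, ← SModEq.zero]
  refine (polyOf_smodEq_filter le_rfl hω ?_).symm.trans (SModEq.zero.2 ?_)
  · simp only [List.mem_flatMap]
    rintro y ⟨q, hq, hy⟩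
    rw [(length_and_sum_of_mem_sqList hy).1, (hs q hq).2.2]
  · induction squares with
    | nil => exact zero_mem _
    | cons q squares ih =>
      rw [List.forall_mem_cons] at hs
      rw [List.flatMap_cons, polyOf_append, ← sq_mono_ofList _ hs.1.2.2]
      exact add_mem (sq_mem_stablyNegligible hs.1.1 hs.1.2.1 _) (ih hs.2)

namespace IsReduction

theorem addTerms_smodEq (hf : IsReduction k N f) (hL : ∀ z ∈ x :: L, z.length = k)
    (hr : f x = some r) : (∀ z ∈ addTerms r L, z.length = k) ∧
      polyOf k (x :: L) ≡ polyOf k (addTerms r L) [SMOD N] := by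
  rw [List.forall_mem_cons] at hL
  obtain ⟨hlen, heq⟩ := hf x r hL.1 hr
  refine ⟨fun z hz => (mem_of_mem_addTerms hz).elim (hlen z) (hL.2 z), ?_⟩
  rw [polyOf_cons, polyOf_addTerms]
  exact heq.add SModEq.rfl

theorem descend_smodEq (hf : IsReduction k N f) {n : ℕ} (hL : ∀ z ∈ L, z.length = k)
    (hr : descend f x n L = some r) :
    (∀ z ∈ r, z.length = k) ∧ polyOf k L ≡ polyOf k r [SMOD N] := by
  induction n generalizing L with
  | zero => simp [descend] at hr
  | succ n ih =>
    cases L with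
    | nil =>
      obtain rfl := Option.some.inj hr
      exact ⟨hL, SModEq.rfl⟩
    | cons y L =>
      rw [descend, force_eq] at hr
      split_ifs at hr with hy
      · obtain rfl := Option.some.inj hr
        exact ⟨hL, SModEq.rfl⟩
      · obtain ⟨r', hr', hr⟩ := Option.bind_eq_some_iff.1 hr
        obtain ⟨hlen, heq⟩ := hf.addTerms_smodEq hL hr'
        exact ⟨(ih hlen hr).1, heq.trans (ih hlen hr).2⟩

theorem normalForm_smodEq (hf : IsReduction k N f) (n : ℕ) (hL : ∀ z ∈ L, z.length = k) :
    polyOf k L ≡ polyOf k (normalForm f n L) [SMOD N] := by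
  induction n generalizing L with
  | zero => rfl
  | succ n ih =>
    cases L with
    | nil => rfl
    | cons y L =>
      rw [normalForm, force_eq]
      split
      next r hr =>
        obtain ⟨hlen, heq⟩ := hf.addTerms_smodEq hL hr
        exact heq.trans (ih hlen)
      next => exact SModEq.rfl.add (ih (List.forall_mem_cons.1 hL).2)

theorem rewrite (hf : IsReduction k (stablyNegligible k ω w.length) f) {rules : List Rule}
    (hω : ∀ i < w.length, ω i = w.getD i 0) (hrules : ∀ R ∈ rules, ∀ q ∈ R.squares,
      1 ≤ q.1 ∧ q.1 < 2 ^ w.length ∧ q.2.length = k) :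
    IsReduction k (stablyNegligible k ω w.length) (HitProblem.rewrite f w rules) := by
  intro x r hx hr
  obtain ⟨R, hR, hr⟩ := List.exists_of_findSome?_eq_some hr
  obtain ⟨h, -, hr⟩ := List.exists_of_findSome?_eq_some hr
  split_ifs at hr
  obtain ⟨p, hp, hr⟩ := List.exists_of_findSome?_eq_some hr
  have hperm := perm_range_of_mem_matchings hp
  rw [hx] at hperm
  have hlen := length_of_mem_relation (w := w) fun q hq => (hrules R hR q hq).2.2
  have hrel := polyOf_map_permute_mem hperm hlen (polyOf_relation_mem hω (hrules R hR))
  have hterms : ∀ z ∈ x :: (relation w R.squares).map (permute p), z.length = k := by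
    refine List.forall_mem_cons.2 ⟨hx, fun z hz => ?_⟩
    obtain ⟨y, -, rfl⟩ := List.mem_map.1 hz
    rw [permute, List.length_map, hperm.length_eq, List.length_range]
  obtain ⟨hlen', heq⟩ := hf.descend_smodEq
    (fun z hz => hterms z ((mem_of_mem_addTerms hz).resolve_right List.not_mem_nil)) hr
  refine ⟨hlen', .trans ?_ heq⟩
  rw [polyOf_addTerms, polyOf_nil, add_zero, polyOf_cons]
  simpa using SModEq.rfl.add (SModEq.zero.2 hrel).symm

end IsReduction

theorem ofList_addDigits {b : List ℕ} (hx : x.length = k) (hb : b.length = k) :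
    ofList k (addDigits s x b) = ofList k x + 2 ^ s • ofList k b := by
  ext j
  simp [ofList_apply, addDigits, hx, hb]

theorem addDigits_mod_div (s : ℕ) (x : List ℕ) :
    addDigits s (x.map (· % 2 ^ s)) (x.map (· / 2 ^ s)) = x := by
  rw [addDigits, List.zipWith_map, List.zipWith_self]
  simp [Nat.mod_add_div]

theorem polyOf_map_addDigits {b : List ℕ} (hL : ∀ x ∈ L, x.length = k) (hb : b.length = k) :
    polyOf k (L.map fun x => addDigits s x b) = polyOf k L * mono (ofList k b) ^ 2 ^ s := by
  induction L with
  | nil => exact (zero_mul _).symm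
  | cons x L ih =>
    rw [List.forall_mem_cons] at hL
    rw [List.map_cons, polyOf_cons, ih hL.2, ofList_addDigits hL.1 hb, ← mono_mul, ← mono_pow,
      polyOf_cons, add_mul]

theorem IsReduction.lift (hf : IsReduction k (stablyNegligible k ω s) f) :
    IsReduction k (stablyNegligible k ω s) (lift s f) := by
  intro x r' hx hr'
  obtain ⟨r, hr, rfl⟩ := Option.map_eq_some_iff.1 hr'
  obtain ⟨hlen, heq⟩ := hf _ r (by simpa using hx) hr
  have hb : (x.map (· / 2 ^ s)).length = k := by simpa using hx
  refine ⟨?_, ?_⟩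
  · simp only [List.mem_map]
    rintro _ ⟨y, hy, rfl⟩
    simp [addDigits, hlen y hy, hx]
  · conv_lhs => rw [← addDigits_mod_div s x]
    rw [ofList_addDigits (by simpa using hx) hb, ← mono_mul, ← mono_pow,
      polyOf_map_addDigits hlen hb, SModEq.sub_mem, ← sub_mul]
    exact mul_pow_mem_stablyNegligible (SModEq.sub_mem.1 heq) _

theorem isReduction_step {st : List Stage} (hst : IsValid k w st) (hω : ω = w.toFinsupp)
    (hs : ∀ a ∈ st, a.w.length ≤ s) : IsReduction k (stablyNegligible k ω s) (step st) := by
  obtain ⟨hsorted, hvalid⟩ := hst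
  induction st generalizing s with
  | nil => exact fun _ _ _ h => by simp [step] at h
  | cons a st ih =>
    rw [List.pairwise_cons] at hsorted
    rw [List.forall_mem_cons] at hs hvalid
    obtain ⟨⟨t, ht⟩, hsquares⟩ := hvalid.1
    have hωa : ∀ i < a.w.length, ω i = a.w.getD i 0 := fun i hi => by
      rw [hω, List.toFinsupp_apply, ← ht, List.getD_append _ _ _ _ hi]
    intro x r hx hr
    rw [step, Option.or_eq_some_iff] at hr
    rcases hr with hr | ⟨-, hr⟩
    · exact ih hs.2 hsorted.2 hvalid.2 x r hx hr
    · have hlift := ((ih hsorted.1 hsorted.2 hvalid.2).rewrite hωa hsquares).lift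
      obtain ⟨hlen, heq⟩ := hlift x r hx hr
      exact ⟨hlen, heq.mono (stablyNegligible_mono hs.1)⟩

end Rewriting

section Quotient

variable {k : ℕ} {ω : ℕ →₀ ℕ} {f g : P k}

theorem sum_two_pow_mul_digit (a n : ℕ) :
    ∑ i ∈ Finset.range n, 2 ^ i * (a / 2 ^ i % 2) = a % 2 ^ n := by
  induction n with
  | zero => simp [Nat.mod_one]
  | succ n ih => rw [Finset.sum_range_succ, ih, Nat.mod_pow_succ]

theorem wdeg_weight (x : Fin k →₀ ℕ) : wdeg (weight x) = x.degree := by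
  have hsum : wdeg (weight x) = ∑ i ∈ Finset.range x.degree, 2 ^ i * weight x i :=
    Finsupp.sum_of_support_subset _ Finsupp.support_onFinset_subset _ fun _ _ => mul_zero _
  simp only [hsum, weight_apply, Finset.mul_sum]
  rw [Finset.sum_comm, Finsupp.degree_eq_sum]
  refine Finset.sum_congr rfl fun j _ => ?_
  rw [sum_two_pow_mul_digit, ← Finsupp.degree_eq_sum]
  exact Nat.mod_eq_of_lt ((Finsupp.le_degree j x).trans_lt Nat.lt_two_pow_self)

theorem isHomogeneous_mono (y : Fin k →₀ ℕ) : (mono y : P k).IsHomogeneous y.degree :=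
  isHomogeneous_monomial 1 rfl

theorem isHomogeneous_sq_mono (n : ℕ) (y : Fin k →₀ ℕ) :
    (sq k n (mono y)).IsHomogeneous (y.degree + n) := by
  obtain ⟨l, hl, rfl⟩ := exists_eq_ofList y
  rw [sq_mono_ofList n hl, ← mem_homogeneousSubmodule]
  refine polyOf_mem fun m hm => (mem_homogeneousSubmodule _ _).2 ?_
  obtain ⟨hlen, hsum⟩ := length_and_sum_of_mem_sqList hm
  rw [degree_ofList hl, ← hsum, ← degree_ofList (hlen.trans hl)]
  exact isHomogeneous_mono _

theorem homogeneousComponent_mem_hit (d : ℕ) (hf : f ∈ hit k) :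
    homogeneousComponent d f ∈ hit k := by
  suffices h : hit k ≤ (hit k).comap (homogeneousComponent d) from h hf
  refine hit_le fun n hn y => ?_
  rw [Submodule.mem_comap, homogeneousComponent_of_mem (isHomogeneous_sq_mono n y)]
  split_ifs
  · exact sq_mem_hit hn _
  · exact zero_mem _

theorem homogeneousComponent_mem_restrictSupport (d : ℕ) {s : Set (Fin k →₀ ℕ)}
    (hf : f ∈ restrictSupport (ZMod 2) s) :
    homogeneousComponent d f ∈ restrictSupport (ZMod 2) {y ∈ s | y.degree = d} := by
  refine (mem_restrictSupport_iff _).2 fun y hy => ?_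
  rw [Finset.mem_coe, mem_support_iff, coeff_homogeneousComponent] at hy
  split_ifs at hy with h
  · exact ⟨(mem_restrictSupport_iff _).1 hf (mem_support_iff.2 hy), h⟩
  · exact absurd rfl hy

theorem PLt_le_PLe : PLt k ω ≤ PLe k ω :=
  Submodule.span_mono fun _ ⟨y, hd, hlt, hy⟩ => ⟨y, hd, hlt.le, hy⟩

theorem PLt_le_negligible : PLt k ω ≤ negligible k ω := by
  refine Submodule.span_le.2 ?_
  rintro _ ⟨y, -, hy, rfl⟩
  exact mono_mem_negligible hy

theorem isHomogeneous_of_mem_PLe (hf : f ∈ PLe k ω) : f.IsHomogeneous (wdeg ω) := by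
  suffices h : PLe k ω ≤ homogeneousSubmodule (Fin k) (ZMod 2) (wdeg ω) from
    (mem_homogeneousSubmodule _ _).1 (h hf)
  refine Submodule.span_le.2 ?_
  rintro _ ⟨y, hy, -, rfl⟩
  exact hy ▸ isHomogeneous_mono y

theorem homogeneousComponent_mem_of_mem_negligible (hf : f ∈ negligible k ω) :
    homogeneousComponent (wdeg ω) f ∈ hit k ⊔ PLt k ω := by
  obtain ⟨h, hh, p, hp, rfl⟩ := Submodule.mem_sup.1 hf
  rw [map_add]
  refine Submodule.add_mem_sup (homogeneousComponent_mem_hit _ hh)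
    (Submodule.span_mono ?_ (mem_span_of_support (fun y => toLex (weight y) < toLex ω ∧
      y.degree = wdeg ω) _ (homogeneousComponent_mem_restrictSupport _ hp)))
  rintro _ ⟨y, ⟨hlt, hd⟩, rfl⟩
  exact ⟨y, hd, hlt, rfl⟩

theorem relations_eq_submoduleOf : relations k ω = (negligible k ω).submoduleOf (PLe k ω) := by
  ext ⟨f, hf⟩
  change f ∈ (hit k ⊓ PLe k ω) ⊔ PLt k ω ↔ f ∈ negligible k ω
  constructor
  · have hle : (hit k ⊓ PLe k ω) ⊔ PLt k ω ≤ negligible k ω :=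
      sup_le (inf_le_left.trans hit_le_negligible) PLt_le_negligible
    exact fun h => hle h
  · intro h
    have h := homogeneousComponent_mem_of_mem_negligible h
    rw [homogeneousComponent_of_mem (isHomogeneous_of_mem_PLe hf), if_pos rfl] at h
    rw [sup_comm, ← sup_inf_assoc_of_le _ PLt_le_PLe, sup_comm]
    exact ⟨h, hf⟩

theorem cls_eq_cls_iff (hf : f ∈ PLe k ω) (hg : g ∈ PLe k ω) :
    cls f hf = cls g hg ↔ f - g ∈ negligible k ω := by
  rw [cls, cls, Submodule.mkQ_apply, Submodule.mkQ_apply, Submodule.Quotient.eq,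
    relations_eq_submoduleOf]
  rfl

/-- The polynomials which are congruent to an element of `P_k(ω)` with class in `M`, modulo
negligible polynomials. -/
noncomputable def preimage (M : Submodule (ZMod 2) (QP k ω)) : Submodule (ZMod 2) (P k) :=
  (M.comap (relations k ω).mkQ).map (PLe k ω).subtype ⊔ negligible k ω

theorem mem_preimage_iff {M : Submodule (ZMod 2) (QP k ω)} (hf : f ∈ PLe k ω) :
    f ∈ preimage M ↔ cls f hf ∈ M := by
  constructor
  · intro h
    obtain ⟨_, ⟨⟨p, hp⟩, hpM, rfl⟩, q, hq, rfl⟩ := Submodule.mem_sup.1 h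
    have hcls : cls _ hf = cls p hp := (cls_eq_cls_iff _ _).2 (by simpa using hq)
    rwa [hcls]
  · exact fun h => Submodule.mem_sup_left ⟨⟨f, hf⟩, h, rfl⟩

theorem eq_top_of_PLe_le_preimage {M : Submodule (ZMod 2) (QP k ω)} (h : PLe k ω ≤ preimage M) :
    M = ⊤ := by
  refine eq_top_iff.2 fun v _ => ?_
  obtain ⟨⟨f, hf⟩, rfl⟩ := (relations k ω).mkQ_surjective v
  exact (mem_preimage_iff hf).1 (h hf)

theorem subst_mem_preimage (W : Subrepresentation (QPRep k ω)) (A : GL (Fin k) (ZMod 2))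
    (hf : f ∈ preimage W.toSubmodule) : subst A.1 f ∈ preimage W.toSubmodule := by
  obtain ⟨_, ⟨p, hp, rfl⟩, q, hq, rfl⟩ := Submodule.mem_sup.1 hf
  rw [map_add]
  exact Submodule.add_mem_sup ⟨PLeRep k ω A p, W.apply_mem_toSubmodule A hp, rfl⟩
    (subst_mem_negligible A.1 hq)

end Quotient

section AdmissibleBasis

variable {k : ℕ} {ω : ℕ →₀ ℕ} {x : Fin k →₀ ℕ}

theorem inadmissible_of_mem_sup
    (h : mono x ∈ hit k ⊔ restrictSupport (ZMod 2) {y | MonoLT y x}) : Inadmissible x := by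
  obtain ⟨q, hq, p, hp, hqp⟩ := Submodule.mem_sup.1 h
  refine ⟨p.support, fun y hy => (mem_restrictSupport_iff _).1 hp hy, ?_⟩
  have hone : ∀ c : ZMod 2, c ≠ 0 → c = 1 := by decide
  have hsum : ∑ y ∈ p.support, mono y = p := by
    conv_rhs => rw [p.as_sum]
    refine Finset.sum_congr rfl fun y hy => ?_
    rw [hone _ (mem_support_iff.1 hy)]
  rwa [hsum, ← hqp, add_assoc, CharTwo.add_self_eq_zero, add_zero]

theorem inadmissible_iff : Inadmissible x ↔ mono x ∈ negligible k (weight x) ⊔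
    restrictSupport (ZMod 2) {y | weight y = weight x ∧ toLex y < toLex x} := by
  constructor
  · rintro ⟨S, hS, hhit⟩
    rw [← add_sub_cancel_right (mono x) (∑ y ∈ S, mono y)]
    refine sub_mem (Submodule.mem_sup_left (hit_le_negligible hhit)) (sum_mem fun y hy => ?_)
    obtain ⟨-, hlt | hlt⟩ := hS y hy
    · exact Submodule.mem_sup_left (mono_mem_negligible hlt)
    · exact Submodule.mem_sup_right ((monomial_mem_restrictSupport _).2 (.inl hlt))
  · intro h
    obtain ⟨q, hq, p, hp, hqp⟩ := Submodule.mem_sup.1 h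
    obtain ⟨h, hh, r, hr, rfl⟩ := Submodule.mem_sup.1 hq
    have hd := homogeneousComponent_of_mem (m := x.degree) (isHomogeneous_mono x)
    rw [if_pos rfl, ← hqp, map_add, map_add] at hd
    refine inadmissible_of_mem_sup ?_
    rw [← hqp, ← hd]
    refine add_mem (Submodule.add_mem_sup (homogeneousComponent_mem_hit _ hh)
      (restrictSupport_mono _ ?_ (homogeneousComponent_mem_restrictSupport _ hr)))
      (Submodule.mem_sup_right (restrictSupport_mono _ ?_
        (homogeneousComponent_mem_restrictSupport _ hp)))
    · exact fun y hy => ⟨hy.2, .inl hy.1⟩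
    · exact fun y hy => ⟨hy.2, .inr hy.1⟩

theorem mono_mem_PLe (hx : weight x = ω) : mono x ∈ PLe k ω :=
  Submodule.subset_span ⟨x, by rw [← hx, wdeg_weight], hx ▸ le_rfl, rfl⟩

theorem PLe_le_of_mono_mem {N : Submodule (ZMod 2) (P k)} (hN : negligible k ω ≤ N)
    (hadm : ∀ x ∈ admissibleMonomials k ω, mono x ∈ N) : PLe k ω ≤ N := by
  have hweight (x : Lex (Fin k →₀ ℕ)) (hx : weight (ofLex x) = ω) : mono (ofLex x) ∈ N := by
    induction x using WellFoundedLT.induction with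
    | ind x ih =>
      by_cases hinad : Inadmissible (ofLex x)
      · rw [inadmissible_iff, hx, restrictSupport_eq_span] at hinad
        refine sup_le hN (Submodule.span_le.2 ?_) hinad
        rintro _ ⟨y, ⟨hy, hlt⟩, rfl⟩
        exact ih (toLex y) hlt hy
      · exact hadm _ ⟨hinad, hx⟩
  refine Submodule.span_le.2 ?_
  rintro _ ⟨y, -, hy, rfl⟩
  rcases hy.lt_or_eq with hy | hy
  · exact hN (mono_mem_negligible hy)
  · exact hweight (toLex y) (toLex.injective hy)

theorem linearIndepOn_of_notMem_span_lt {K V ι : Type*} [DivisionRing K] [AddCommGroup V]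
    [Module K V] [LinearOrder ι] {v : ι → V} {s : Set ι}
    (h : ∀ i ∈ s, v i ∉ Submodule.span K (v '' {j ∈ s | j < i})) : LinearIndepOn K v s := by
  refine linearIndepOn_of_finite s fun t hts ht => ?_
  lift t to Finset ι using ht
  induction t using Finset.induction_on_max with
  | empty => simp
  | insert i t hlt ih =>
    rw [Finset.coe_insert, Set.insert_subset_iff] at hts
    rw [Finset.coe_insert]
    refine (ih hts.2).insert fun hi => h i hts.1 (Submodule.span_mono (Set.image_mono ?_) hi)
    exact fun j hj => ⟨hts.2 hj, hlt j hj⟩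

theorem linearIndependent_mkQ_mono : LinearIndependent (ZMod 2)
    fun x : admissibleMonomials k ω => (negligible k ω).mkQ (mono x.1) := by
  have hind : LinearIndepOn (ZMod 2) (fun x => (negligible k ω).mkQ (mono (ofLex x)))
      (ofLex ⁻¹' admissibleMonomials k ω) := by
    refine linearIndepOn_of_notMem_span_lt fun x hx hmem => hx.1 (inadmissible_iff.2 ?_)
    rw [← Function.comp_def (negligible k ω).mkQ, Set.image_comp, Submodule.span_image] at hmem
    obtain ⟨p, hp, hpx⟩ := hmem
    rw [hx.2, ← sub_add_cancel (mono (ofLex x)) p]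
    refine Submodule.add_mem_sup ((Submodule.Quotient.eq _).1 hpx.symm) ?_
    suffices h : _ ≤ restrictSupport (ZMod 2) _ from h hp
    refine Submodule.span_le.2 ?_
    rintro _ ⟨y, ⟨hy, hlt⟩, rfl⟩
    exact (monomial_mem_restrictSupport _).2 (.inl ⟨hy.2, hlt⟩)
  exact hind

theorem exists_basis_admissibleMonomials : ∃ b : Module.Basis (admissibleMonomials k ω) (ZMod 2)
    (QP k ω), ∀ x, b x = cls (mono x.1) (mono_mem_PLe x.2.2) := by
  have hind : LinearIndependent (ZMod 2)
      fun x : admissibleMonomials k ω => cls (mono x.1) (mono_mem_PLe x.2.2) :=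
    .of_comp (Submodule.mapQ (relations k ω) (negligible k ω) (PLe k ω).subtype
      relations_eq_submoduleOf.le) linearIndependent_mkQ_mono
  have htop := eq_top_of_PLe_le_preimage (M := Submodule.span (ZMod 2) (Set.range
    fun x : admissibleMonomials k ω => cls (mono x.1) (mono_mem_PLe x.2.2)))
    (PLe_le_of_mono_mem le_sup_right fun x hx =>
      (mem_preimage_iff (mono_mem_PLe hx.2)).2 (Submodule.subset_span ⟨⟨x, hx⟩, rfl⟩))
  exact ⟨.mk hind htop.ge, fun x => Module.Basis.mk_apply hind htop.ge x⟩

theorem generates_cls_mono (hx : weight x = ω)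
    (h : ∀ N : Submodule (ZMod 2) (P k), negligible k ω ≤ N →
      (∀ (A : GL (Fin k) (ZMod 2)), ∀ f ∈ N, subst A.1 f ∈ N) → mono x ∈ N →
        ∀ y ∈ admissibleMonomials k ω, mono y ∈ N) :
    Generates (cls (mono x) (mono_mem_PLe hx)) := fun W hW =>
  eq_top_of_PLe_le_preimage (PLe_le_of_mono_mem le_sup_right (h _ le_sup_right
    (fun A _ hf => subst_mem_preimage W A hf) ((mem_preimage_iff _).2 hW)))

theorem exists_basis_of_admissibleMonomials_eq_image {a : ℕ → Fin k →₀ ℕ} {s : Set ℕ}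
    (hinj : Set.InjOn a s) (h : admissibleMonomials k ω = a '' s) :
    ∃ hmem : ∀ t ∈ s, mono (a t) ∈ PLe k ω, ∃ b : Module.Basis s (ZMod 2) (QP k ω),
      ∀ t : s, b t = cls (mono (a t)) (hmem t t.2) := by
  have hweight (t : ℕ) (ht : t ∈ s) : weight (a t) = ω :=
    (h.ge (Set.mem_image_of_mem a ht)).2
  obtain ⟨b, hb⟩ := exists_basis_admissibleMonomials (k := k) (ω := ω)
  let e := (Equiv.Set.imageOfInjOn a s hinj).trans (Equiv.setCongr h.symm)
  exact ⟨fun t ht => mono_mem_PLe (hweight t ht), b.reindex e.symm, fun t => by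
    rw [Module.Basis.reindex_apply, hb]
    rfl⟩

end AdmissibleBasis

section Survivors

/-- The `0`-`1` lists of length `k` with sum `a`. -/
def bitLists (k a : ℕ) : List (List ℕ) := (List.replicate k [0, 1]).sections.filter (·.sum == a)

/-- The reduction `f` replaces `x` by smaller monomials of weight `w`. -/
def isReducible (w : List ℕ) (f : List ℕ → Option (List (List ℕ))) (x : List ℕ) : Bool :=
  (f x).any fun r => r.all fun y => lexLt y x && hasWeight w y

/-- A list containing the residues modulo `2ⁿ` of all admissible monomials of weight `w`, built
digit by digit. For `i ≤ n`, no residue modulo `2ⁱ` is reducible by the stages of length at most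
`i`. -/
def survivors (k : ℕ) (st : List Stage) (w : List ℕ) : ℕ → List (List ℕ)
  | 0 => [List.replicate k 0]
  | n + 1 => ((survivors k st w n).flatMap fun y =>
      (bitLists k (w.getD n 0)).map (addDigits n y)).filter fun x => force x fun x =>
        !isReducible (w.take (n + 1)) (step (st.filter (·.w.length ≤ n + 1))) x

variable {k n : ℕ} {ω : ℕ →₀ ℕ} {w x : List ℕ} {st : List Stage}

theorem weight_add_two_pow_smul_of_le {i : ℕ} (hi : n ≤ i) {u : Fin k →₀ ℕ} (hu : ∀ j, u j < 2 ^ n)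
    (v : Fin k →₀ ℕ) : weight (u + 2 ^ n • v) i = weight v (i - n) := by
  obtain ⟨d, rfl⟩ := Nat.exists_eq_add_of_le hi
  simp only [weight_apply, Finsupp.add_apply, Finsupp.smul_apply, smul_eq_mul]
  refine Finset.sum_congr rfl fun j _ => ?_
  rw [pow_add, ← Nat.div_div_eq_div_mul, Nat.add_mul_div_left _ _ (by positivity),
    Nat.div_eq_of_lt (hu j), zero_add, Nat.add_sub_cancel_left]

theorem mul_mono_mem_restrictSupport {S T : Set (Fin k →₀ ℕ)} {z : Fin k →₀ ℕ}
    (h : ∀ y ∈ S, y + z ∈ T) {p : P k} (hp : p ∈ restrictSupport (ZMod 2) S) :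
    p * mono z ∈ restrictSupport (ZMod 2) T := by
  refine (mem_restrictSupport_iff _).2 fun y hy => ?_
  obtain ⟨u, hu, v, hv, rfl⟩ := Finset.mem_add.1 (support_mul _ _ hy)
  obtain rfl := Finset.mem_singleton.1 (support_monomial_subset hv)
  exact h u ((mem_restrictSupport_iff _).1 hp hu)

theorem inadmissible_add_two_pow_smul {u v : Fin k →₀ ℕ} (hu : ∀ j, u j < 2 ^ n)
    (h : mono u ∈ stablyNegligible k (weight (u + 2 ^ n • v)) n ⊔ restrictSupport (ZMod 2)
      {y | (∀ j, y j < 2 ^ n) ∧ (∀ i < n, weight y i = weight u i) ∧ toLex y < toLex u}) :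
    Inadmissible (u + 2 ^ n • v) := by
  obtain ⟨f, hf, p, hp, hfp⟩ := Submodule.mem_sup.1 h
  rw [inadmissible_iff, ← mono_mul, ← mono_pow, ← hfp, add_mul]
  refine Submodule.add_mem_sup ?_ ?_
  · exact mem_stablyNegligible.1 hf _
  · rw [mono_pow]
    refine mul_mono_mem_restrictSupport ?_ hp
    rintro y ⟨hy, hweight, hlt⟩
    refine ⟨?_, ?_⟩
    · ext i
      rcases lt_or_ge i n with hi | hi
      · rw [weight_add_two_pow_smul hi, weight_add_two_pow_smul hi, hweight i hi]
      · rw [weight_add_two_pow_smul_of_le hi hy, weight_add_two_pow_smul_of_le hi hu]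
    · rw [toLex_add, toLex_add]
      exact add_lt_add_left hlt _

theorem mem_bitLists (hx : ∀ a ∈ x, a ∈ [0, 1]) : x ∈ bitLists x.length x.sum := by
  rw [bitLists, List.mem_filter, List.mem_sections]
  refine ⟨?_, beq_self_eq_true _⟩
  induction x with
  | nil => exact .nil
  | cons a x ih =>
    rw [List.forall_mem_cons] at hx
    exact .cons hx.1 (ih hx.2)

theorem lt_two_pow_of_weight_eq_zero (h : ∀ i ≥ n, weight (ofList k x) i = 0)
    (hx : x.length = k) : ∀ a ∈ x, a < 2 ^ n := by
  refine fun a ha => Nat.lt_pow_two_of_testBit a fun i hi => ?_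
  have hzero := h i hi
  rw [weight_ofList hx] at hzero
  have hdigit := List.sum_eq_zero_iff.1 hzero _ (List.mem_map_of_mem ha)
  rw [Nat.testBit_eq_decide_div_mod_eq, hdigit]
  rfl

theorem ofList_lt {m : ℕ} (hm : 0 < m) (hx : ∀ a ∈ x, a < m) (j : Fin k) : ofList k x j < m := by
  rw [ofList_apply]
  rcases lt_or_ge j.1 x.length with hj | hj
  · rw [List.getD_eq_getElem _ _ hj]
    exact hx _ (List.getElem_mem hj)
  · rwa [List.getD_eq_default _ _ hj]

theorem inadmissible_of_isReducible {f : List ℕ → Option (List (List ℕ))}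
    (hf : IsReduction k (stablyNegligible k ω n) f) (hω : ω = w.toFinsupp) (hx : x.length = k)
    (hweight : weight (ofList k x) = ω) (hn : n ≤ w.length)
    (h : isReducible (w.take n) f (x.map (· % 2 ^ n))) : Inadmissible (ofList k x) := by
  obtain ⟨r, hr, hsmall⟩ := (Option.any_eq_true _ _).1 h
  obtain ⟨hlen, heq⟩ := hf _ r (by simpa using hx) hr
  have hres : (x.map (· % 2 ^ n)).length = k := by simpa using hx
  have hsplit : ofList k x =
      ofList k (x.map (· % 2 ^ n)) + 2 ^ n • ofList k (x.map (· / 2 ^ n)) := by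
    rw [← ofList_addDigits hres (by simpa using hx), addDigits_mod_div]
  rw [hsplit]
  refine inadmissible_add_two_pow_smul (ofList_lt (by positivity) ?_) ?_
  · simpa using fun a _ => Nat.mod_lt a (by positivity)
  rw [← hsplit, hweight, ← sub_add_cancel (mono _) (polyOf k r)]
  refine Submodule.add_mem_sup (SModEq.sub_mem.1 heq) (polyOf_mem fun y hy => ?_)
  have hy' := List.all_eq_true.1 hsmall y hy
  simp only [hasWeight, Bool.and_eq_true, beq_iff_eq, List.length_take, min_eq_left hn,
    List.all_eq_true, decide_eq_true_eq] at hy'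
  refine (monomial_mem_restrictSupport _).2 (.inl ⟨ofList_lt (by positivity) hy'.2.2,
    fun i hi => ?_, toLex_ofList_lt (hlen y hy) hy'.1⟩)
  rw [← weight_add_two_pow_smul hi (ofList k (x.map _)), ← hsplit, hweight, hω,
    List.toFinsupp_apply, ← getD_digitSums hi (hlen y hy), hy'.2.1]
  simp [hi]

theorem mod_two_pow_mem_survivors (hst : IsValid k w st) (hω : ω = w.toFinsupp)
    (hx : x.length = k) (hadm : ofList k x ∈ admissibleMonomials k ω) (hn : n ≤ w.length) :
    x.map (· % 2 ^ n) ∈ survivors k st w n := by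
  induction n with
  | zero => simp [survivors, hx, Nat.mod_one]
  | succ n ih =>
    rw [survivors, List.mem_filter, force_eq, Bool.not_eq_true', List.mem_flatMap]
    refine ⟨⟨_, ih (Nat.le_of_succ_le hn), List.mem_map.2 ⟨x.map (· / 2 ^ n % 2), ?_, ?_⟩⟩, ?_⟩
    · have hsum : w.getD n 0 = (x.map (· / 2 ^ n % 2)).sum := by
        rw [← weight_ofList hx, hadm.2, hω, List.toFinsupp_apply]
      have hbits := mem_bitLists (x := x.map (· / 2 ^ n % 2)) (by
        simpa using fun a _ => Nat.mod_two_eq_zero_or_one _)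
      rwa [List.length_map, hx, ← hsum] at hbits
    · rw [addDigits, List.zipWith_map, List.zipWith_self]
      simp only [Nat.mod_pow_succ]
    · rw [Bool.eq_false_iff]
      have hf := isReduction_step (s := n + 1) (st := st.filter (·.w.length ≤ n + 1))
        ⟨hst.1.filter _, fun a ha => hst.2 a (List.mem_of_mem_filter ha)⟩ hω (by simp)
      exact fun h => hadm.1 (inadmissible_of_isReducible hf hω hx hadm.2 hn h)

theorem mem_survivors (hst : IsValid k w st) (hω : ω = w.toFinsupp) (hx : x.length = k)
    (hadm : ofList k x ∈ admissibleMonomials k ω) : x ∈ survivors k st w w.length := by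
  have hlt : ∀ a ∈ x, a < 2 ^ w.length := by
    refine lt_two_pow_of_weight_eq_zero (fun i hi => ?_) hx
    rw [hadm.2, hω, List.toFinsupp_apply, List.getD_eq_default _ _ hi]
  have hmem := mod_two_pow_mem_survivors hst hω hx hadm le_rfl
  rwa [List.map_congr_left fun a ha => Nat.mod_eq_of_lt (hlt a ha), List.map_id'] at hmem

end Survivors

section Propagation

/-- For each pair `(b, r)` in `E` such that `b` is in `K`, adds to `K` the only entry of `r` which
is not in `K`, if there is exactly one such entry. -/
def spread (E : List (List ℕ × List (List ℕ))) (K : List (List ℕ)) : List (List ℕ) :=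
  E.foldl (fun K e => if e.1 ∈ K then match e.2.filter (· ∉ K) with
    | [u] => u :: K
    | _ => K
    else K) K

variable {M : Type*} [AddCommGroup M] {S : AddSubgroup M} {e : List ℕ → M}
  {E : List (List ℕ × List (List ℕ))} {K : List (List ℕ)}

theorem mem_of_filter_notMem_eq_singleton {r : List (List ℕ)} {u : List ℕ}
    (hr : (r.map e).sum ∈ S) (hK : ∀ x ∈ K, e x ∈ S) (hu : r.filter (· ∉ K) = [u]) : e u ∈ S := by
  have hperm := ((List.filter_append_perm (· ∈ K) r).map e).sum_eq
  have hu' : r.filter (fun x => !decide (x ∈ K)) = [u] := by simpa using hu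
  rw [hu', List.map_append, List.sum_append, List.map_singleton, List.sum_singleton] at hperm
  refine (S.add_mem_cancel_left (list_sum_mem ?_)).1 (hperm ▸ hr)
  simp only [List.mem_map, List.mem_filter, decide_eq_true_eq]
  rintro _ ⟨x, ⟨-, hx⟩, rfl⟩
  exact hK x hx

theorem mem_of_mem_spread (hE : ∀ q ∈ E, e q.1 ∈ S → (q.2.map e).sum ∈ S)
    (hK : ∀ x ∈ K, e x ∈ S) : ∀ x ∈ spread E K, e x ∈ S := by
  induction E generalizing K with
  | nil => exact hK
  | cons q E ih =>
    rw [List.forall_mem_cons] at hE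
    refine ih hE.2 ?_
    beta_reduce
    split_ifs with hq
    · split
      next u hu =>
        exact List.forall_mem_cons.2
          ⟨mem_of_filter_notMem_eq_singleton (hE.1 (hK _ hq)) hK hu, hK⟩
      next => exact hK
    · exact hK

theorem mem_of_mem_iterate_spread (hE : ∀ q ∈ E, e q.1 ∈ S → (q.2.map e).sum ∈ S)
    (hK : ∀ x ∈ K, e x ∈ S) (n : ℕ) : ∀ x ∈ (spread E)^[n] K, e x ∈ S := by
  induction n with
  | zero => exact hK
  | succ n ih =>
    rw [Function.iterate_succ_apply']
    exact mem_of_mem_spread hE ih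

end Propagation

section Transitions

/-- The image of the monomial `x` under the substitution `F`, modulo negligible polynomials. -/
def image (w : List ℕ) (st : List Stage) (F : List ℕ → List (List ℕ)) (x : List ℕ) :
    List (List ℕ) :=
  normalForm (step st) 200 (addTerms ((F x).filter fun y => !isLower w y) [])

/-- The monomials in `B`, together with their images. -/
def transitions (w : List ℕ) (st : List Stage) (B : List (List ℕ))
    (F : List ℕ → List (List ℕ)) : List (List ℕ × List (List ℕ)) :=
  B.map fun b => (b, image w st F b)

/-- The transposed matrix modulo `2`. -/
def transpose (T : List (List ℕ × List (List ℕ))) : List (List ℕ × List (List ℕ)) :=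
  T.map fun e => (e.1, (T.filter fun e' => e'.2.count e.1 % 2 = 1).map (·.1))

variable {k : ℕ} {ω : ℕ →₀ ℕ} {w : List ℕ} {st : List Stage} {B : List (List ℕ)}
  {Fs : List (List ℕ → List (List ℕ))} {F : List ℕ → List (List ℕ)}

theorem IsSubstitution.exists_subst_smodEq_image (hF : IsSubstitution k F) (hst : IsValid k w st)
    (hω : ω = w.toFinsupp) : ∃ g : GL (Fin k) (ZMod 2), ∀ x : List ℕ, x.length = k →
      subst g.1 (mono (ofList k x)) ≡ polyOf k (image w st F x) [SMOD negligible k ω] := by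
  obtain ⟨g, hg⟩ := hF
  refine ⟨g, fun x hx => ?_⟩
  obtain ⟨hlen, heq⟩ := hg x hx
  have hterms : ∀ y ∈ addTerms ((F x).filter fun y => !isLower w y) [], y.length = k := fun y hy =>
    hlen y (List.mem_of_mem_filter ((mem_of_mem_addTerms hy).resolve_right List.not_mem_nil))
  have hred := isReduction_step hst hω fun a ha => (hst.2 a ha).1.length_le
  have hfilter := polyOf_smodEq_filter (ω := ω) (w := w) le_rfl (fun i _ => by
    rw [hω, List.toFinsupp_apply]) hlen
  have hnormal := hred.normalForm_smodEq 200 hterms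
  rw [polyOf_addTerms, polyOf_nil, add_zero] at hnormal
  rw [heq]
  exact (hfilter.trans hnormal).mono stablyNegligible_le_negligible

theorem mono_mem_of_mem_iterate_spread (hFs : ∀ F ∈ Fs, IsSubstitution k F)
    (hst : IsValid k w st) (hω : ω = w.toFinsupp) (hB : ∀ b ∈ B, b.length = k)
    {N : Submodule (ZMod 2) (P k)} (hN : negligible k ω ≤ N)
    (hsubst : ∀ (A : GL (Fin k) (ZMod 2)), ∀ f ∈ N, subst A.1 f ∈ N) {g : List ℕ}
    (hg : mono (ofList k g) ∈ N) {n : ℕ} {b : List ℕ}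
    (hb : b ∈ (spread (Fs.flatMap (transitions w st B)))^[n] [g]) : mono (ofList k b) ∈ N := by
  refine mem_of_mem_iterate_spread (S := N.toAddSubgroup) (e := fun x => mono (ofList k x))
    ?_ (by simpa using hg) n b hb
  simp only [List.mem_flatMap, transitions, List.mem_map]
  rintro _ ⟨F, hF, c, hc, rfl⟩ hcN
  obtain ⟨A, hA⟩ := (hFs F hF).exists_subst_smodEq_image hst hω
  have hmem := hN (SModEq.sub_mem.1 (hA c (hB c hc)).symm)
  exact (N.sub_mem_iff_left (hsubst A _ hcN)).1 hmem

end Transitions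

section Separation

variable {k : ℕ} {ω : ℕ →₀ ℕ} {w : List ℕ} {st : List Stage} {B : List (List ℕ)}
  {F : List ℕ → List (List ℕ)}

theorem not_inadmissible_of_dual {x : Fin k →₀ ℕ} (hω : weight x = ω)
    {φ : Module.Dual (ZMod 2) (P k)} (hφ : φ ∈ (negligible k ω).dualAnnihilator)
    (hadm : ∀ y ∈ admissibleMonomials k ω, y ≠ x → φ (mono y) = 0) (hx : φ (mono x) ≠ 0) :
    ¬ Inadmissible x := by
  intro hinad
  have hker : PLe k ω ≤ LinearMap.ker φ := PLe_le_of_mono_mem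
    (fun f hf => (Submodule.mem_dualAnnihilator φ).1 hφ f hf) fun y hy =>
      hadm y hy (by rintro rfl; exact hy.1 hinad)
  exact hx (hker (mono_mem_PLe hω))

/-- The vectors of values which functionals vanishing on negligible polynomials take on the
monomials in `B`. -/
noncomputable def dualValues (k : ℕ) (ω : ℕ →₀ ℕ) (B : List (List ℕ)) :
    Submodule (ZMod 2) ({b // b ∈ B} → ZMod 2) :=
  (negligible k ω).dualAnnihilator.map
    (LinearMap.pi fun b => Module.Dual.eval (ZMod 2) (P k) (mono (ofList k b.1)))

/-- The vector with entry `1` at `b` and `0` elsewhere. -/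
def indicator (B : List (List ℕ)) (b : List ℕ) (c : {c // c ∈ B}) : ZMod 2 :=
  if b = c.1 then 1 else 0

theorem count_eq_sum_map_ite (r : List (List ℕ)) (b : List ℕ) :
    (r.count b : ZMod 2) = (r.map fun x => if x = b then 1 else 0).sum := by
  induction r with
  | nil => rfl
  | cons x r ih => simp [List.count_cons, ih, add_comm]

theorem mem_dualValues {v : {b // b ∈ B} → ZMod 2} : v ∈ dualValues k ω B ↔
    ∃ φ ∈ (negligible k ω).dualAnnihilator, ∀ b, φ (mono (ofList k b.1)) = v b :=
  exists_congr fun _ => and_congr_right fun _ => funext_iff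

theorem sum_map_indicator (r : List (List ℕ)) (c : {c // c ∈ B}) :
    (r.map (indicator B)).sum c = r.count c.1 := by
  rw [Pi.list_sum_apply, List.map_map, count_eq_sum_map_ite]
  rfl

theorem sum_transpose_transitions (hB : B.Nodup) (b : List ℕ) (c : {c // c ∈ B}) :
    ((((transitions w st B F).filter fun e => e.2.count b % 2 = 1).map (·.1)).map
      (indicator B)).sum c = (image w st F c.1).count b := by
  have hfilter : ((transitions w st B F).filter fun e => e.2.count b % 2 = 1).map (·.1)
      = B.filter fun b' => (image w st F b').count b % 2 = 1 := by
    rw [transitions, List.filter_map, List.map_map]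
    exact List.map_id _
  rw [sum_map_indicator, hfilter, (hB.filter _).count]
  rcases Nat.mod_two_eq_zero_or_one ((image w st F c.1).count b) with h | h
  · rw [if_neg (by simp [h]), Nat.cast_zero, eq_comm, ZMod.natCast_eq_zero_iff_even]
    exact Nat.even_iff.2 h
  · rw [if_pos (by simp [h, c.2]), Nat.cast_one, eq_comm, ZMod.natCast_eq_one_iff_odd]
    exact Nat.odd_iff.2 h

theorem sum_transpose_mem_dualValues (hF : IsSubstitution k F) (hst : IsValid k w st)
    (hω : ω = w.toFinsupp) (hB : ∀ b ∈ B, b.length = k) (hnodup : B.Nodup)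
    (hclosed : ∀ b ∈ B, image w st F b ⊆ B) {q : List ℕ × List (List ℕ)}
    (hq : q ∈ transpose (transitions w st B F)) (hmem : indicator B q.1 ∈ dualValues k ω B) :
    (q.2.map (indicator B)).sum ∈ dualValues k ω B := by
  obtain ⟨e, -, rfl⟩ := List.mem_map.1 hq
  obtain ⟨φ, hφ, hval⟩ := mem_dualValues.1 hmem
  obtain ⟨A, hA⟩ := hF.exists_subst_smodEq_image hst hω
  rw [Submodule.mem_dualAnnihilator] at hφ
  refine mem_dualValues.2 ⟨φ ∘ₗ (subst A.1).toLinearMap, (Submodule.mem_dualAnnihilator _).2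
    fun f hf => hφ _ (subst_mem_negligible A.1 hf), fun c => ?_⟩
  have himage := hφ _ (SModEq.sub_mem.1 (hA c.1 (hB c.1 c.2)))
  rw [map_sub, sub_eq_zero, map_polyOf] at himage
  rw [sum_transpose_transitions hnodup, LinearMap.comp_apply, AlgHom.toLinearMap_apply, himage]
  rw [count_eq_sum_map_ite]
  refine congrArg List.sum (List.map_congr_left fun x hx => ?_)
  rw [hval ⟨x, hclosed c.1 c.2 hx⟩, indicator]
  exact if_congr eq_comm rfl rfl

/-- The functional whose value on `f` is the sum of the coefficients of the monomials in `C`. -/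
noncomputable def coeffSum (k : ℕ) (C : List (List ℕ)) : Module.Dual (ZMod 2) (P k) :=
  (C.map fun c => lcoeff (ZMod 2) (ofList k c)).sum

/-- The conditions under which `coeffSum k C` vanishes on negligible polynomials. The degrees of
the monomials in `C` are at most `d`, so that no squares `Sqⁿ` with `d < n` lead to them. -/
def IsAnnihilating (k d : ℕ) (w : List ℕ) (C : List (List ℕ)) : Prop :=
  (∀ c ∈ C, c.length = k ∧ c.sum ≤ d ∧ isLower w c = false) ∧
    ∀ n ∈ List.range' 1 d, addTerms (C.flatMap (dualSqList · n)) [] = []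

instance (k d : ℕ) (w : List ℕ) (C : List (List ℕ)) : Decidable (IsAnnihilating k d w C) := by
  unfold IsAnnihilating
  infer_instance

variable {C : List (List ℕ)} {d : ℕ}

theorem coeffSum_polyOf (hC : ∀ c ∈ C, c.length = k) {L : List (List ℕ)}
    (hL : ∀ x ∈ L, x.length = k) :
    coeffSum k C (polyOf k L) = (C.map fun c => (L.count c : ZMod 2)).sum := by
  have happly (f : P k) : coeffSum k C f = (C.map fun c => coeff (ofList k c) f).sum := by
    rw [coeffSum]
    exact (map_list_sum (LinearMap.applyₗ f) _).trans (by rw [List.map_map]; rfl)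
  rw [happly]
  exact congrArg List.sum (List.map_congr_left fun c hc => coeff_polyOf hL (hC c hc))

theorem coeffSum_mono (hC : ∀ c ∈ C, c.length = k) {l : List ℕ} (hl : l.length = k) :
    coeffSum k C (mono (ofList k l)) = C.count l := by
  have hsingle : mono (ofList k l) = polyOf k [l] := by rw [polyOf_cons, polyOf_nil, add_zero]
  rw [hsingle, coeffSum_polyOf hC (by simpa using hl), count_eq_sum_map_ite]
  refine congrArg List.sum (List.map_congr_left fun c _ => ?_)
  rw [List.count_singleton, Nat.cast_ite, Nat.cast_one, Nat.cast_zero]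
  exact if_congr (beq_iff_eq.trans eq_comm) rfl rfl

theorem isLower_of_weight_lt {l : List ℕ} (hω : ω = w.toFinsupp) (hl : l.length = k)
    (h : toLex (weight (ofList k l)) < toLex ω) : isLower w l := by
  obtain ⟨i, heq, hlt⟩ := Finsupp.Lex.lt_iff.1 h
  have hi : i < w.length := by
    by_contra hi
    rw [ofLex_toLex, ofLex_toLex, hω, List.toFinsupp_apply,
      List.getD_eq_default _ _ (not_lt.1 hi)] at hlt
    exact Nat.not_lt_zero _ hlt
  refine lexLt_of_lt (i := i) (by simpa [digitSums] using hi) hi (fun j hj => ?_) ?_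
  · rw [getD_digitSums (hj.trans hi) hl, ← List.toFinsupp_apply, ← hω]
    exact heq j hj
  · rw [getD_digitSums hi hl, ← List.toFinsupp_apply, ← hω]
    exact hlt

theorem coeffSum_sq_mono (hC : IsAnnihilating k d w C) {n : ℕ} (hn : 1 ≤ n) {l : List ℕ}
    (hl : l.length = k) : coeffSum k C (sq k n (mono (ofList k l))) = 0 := by
  rw [sq_mono_ofList n hl, coeffSum_polyOf (fun c hc => (hC.1 c hc).1) fun m hm =>
    (length_and_sum_of_mem_sqList hm).1.trans hl]
  rcases lt_or_ge d n with hd | hd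
  · refine List.sum_eq_zero ?_
    simp only [List.mem_map]
    rintro _ ⟨c, hc, rfl⟩
    rw [List.count_eq_zero_of_not_mem fun hmem => ?_, Nat.cast_zero]
    have := (length_and_sum_of_mem_sqList hmem).2
    have := (hC.1 c hc).2.1
    omega
  · have hlen : ∀ m ∈ C.flatMap (dualSqList · n), m.length = k := by
      simp only [List.mem_flatMap]
      rintro m ⟨c, hc, hm⟩
      exact (length_of_mem_dualSqList hm).trans (hC.1 c hc).1
    have hzero := polyOf_addTerms (k := k) (C.flatMap (dualSqList · n)) []
    rw [hC.2 n (List.mem_range'_1.2 ⟨hn, by omega⟩), polyOf_nil, add_zero] at hzero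
    have hcount := coeff_polyOf hlen hl
    rw [← hzero, coeff_zero, List.count_flatMap, Nat.cast_list_sum, List.map_map] at hcount
    simpa [Function.comp_def, count_dualSqList] using hcount.symm

theorem coeffSum_mem_dualAnnihilator (hω : ω = w.toFinsupp) (hC : IsAnnihilating k d w C) :
    coeffSum k C ∈ (negligible k ω).dualAnnihilator := by
  suffices h : negligible k ω ≤ LinearMap.ker (coeffSum k C) from
    (Submodule.mem_dualAnnihilator _).2 fun f hf => h hf
  refine sup_le (hit_le fun n hn y => ?_) ?_
  · obtain ⟨l, hl, rfl⟩ := exists_eq_ofList y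
    exact coeffSum_sq_mono hC hn hl
  · rw [lowWeight, restrictSupport_eq_span, Submodule.span_le]
    rintro _ ⟨y, hy, rfl⟩
    obtain ⟨l, hl, rfl⟩ := exists_eq_ofList y
    have hlow := isLower_of_weight_lt hω hl hy
    change coeffSum k C (mono (ofList k l)) = 0
    rw [coeffSum_mono (fun c hc => (hC.1 c hc).1) hl, List.count_eq_zero_of_not_mem, Nat.cast_zero]
    exact fun hmem => by simp [(hC.1 l hmem).2.2] at hlow

theorem not_inadmissible_of_indicator_mem {b : List ℕ} (hb : b ∈ B)
    (hweight : weight (ofList k b) = ω)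
    (hadm : ∀ x : List ℕ, x.length = k → ofList k x ∈ admissibleMonomials k ω → x ∈ B)
    (h : indicator B b ∈ dualValues k ω B) : ¬ Inadmissible (ofList k b) := by
  obtain ⟨φ, hφ, hval⟩ := mem_dualValues.1 h
  refine not_inadmissible_of_dual hweight hφ (fun y hy hne => ?_) ?_
  · obtain ⟨x, hx, rfl⟩ := exists_eq_ofList y
    rw [hval ⟨x, hadm x hx hy⟩, indicator, if_neg]
    rintro rfl
    exact hne rfl
  · rw [hval ⟨b, hb⟩, indicator, if_pos rfl]
    exact one_ne_zero

end Separation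

section Certificate

/-- A verifiable computation of `QP_k(ω)`, where `ω` is given by `w`, with the set `B` of exponents
of the admissible monomials of weight `ω`. The residues which survive rewriting by `st` lie in `B`;
the images of the monomials in `B` under the substitutions in `Fs` are sums of monomials in `B`;
these images lead from `g` to all of `B`; and they lead from the functional which is dual to
`h ∈ B`, given by the monomials in `C`, to the functionals which are dual to all of `B`. -/
structure IsBasisCertificate (k : ℕ) (w : List ℕ) (st : List Stage)
    (Fs : List (List ℕ → List (List ℕ))) (B : List (List ℕ)) (g h : List ℕ)
    (C : List (List ℕ)) : Prop where
  isValid : IsValid k w st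
  nodup : B.Nodup
  length_and_hasWeight : ∀ b ∈ B, b.length = k ∧ hasWeight w b
  survivors_subset : ∀ x ∈ survivors k st w w.length, x ∈ B
  generator_mem : g ∈ B
  isAnnihilating : ∃ d, IsAnnihilating k d w C
  separates : ∀ b ∈ B, C.count b % 2 = if h = b then 1 else 0
  -- A single conjunction, so that the kernel computes the images only once.
  images : ∃ n, (∀ F ∈ Fs, ∀ b ∈ B, ∀ y ∈ image w st F b, y ∈ B) ∧
    (∀ b ∈ B, b ∈ (spread (Fs.flatMap (transitions w st B)))^[n] [g]) ∧
    ∀ b ∈ B, b ∈ (spread (Fs.flatMap fun F => transpose (transitions w st B F)))^[n] [h]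

namespace IsBasisCertificate

variable {k : ℕ} {ω : ℕ →₀ ℕ} {w : List ℕ} {st : List Stage}
  {Fs : List (List ℕ → List (List ℕ))} {B C : List (List ℕ)} {g h : List ℕ}

theorem indicator_separator_mem_dualValues (cert : IsBasisCertificate k w st Fs B g h C)
    (hω : ω = w.toFinsupp) : indicator B h ∈ dualValues k ω B := by
  obtain ⟨d, hC⟩ := cert.isAnnihilating
  refine mem_dualValues.2 ⟨coeffSum k C, coeffSum_mem_dualAnnihilator hω hC, fun b => ?_⟩
  rw [coeffSum_mono (fun c hc => (hC.1 c hc).1) (cert.length_and_hasWeight b.1 b.2).1,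
    ← ZMod.natCast_mod, cert.separates b.1 b.2, Nat.cast_ite, Nat.cast_one, Nat.cast_zero]
  rfl

theorem indicator_mem_dualValues (cert : IsBasisCertificate k w st Fs B g h C)
    (hω : ω = w.toFinsupp) (hFs : ∀ F ∈ Fs, IsSubstitution k F) {b : List ℕ} (hb : b ∈ B) :
    indicator B b ∈ dualValues k ω B := by
  obtain ⟨n, hclosed, -, hn⟩ := cert.images
  refine mem_of_mem_iterate_spread (S := (dualValues k ω B).toAddSubgroup) (fun q hq => ?_)
    (by simpa using cert.indicator_separator_mem_dualValues hω) n b (hn b hb)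
  obtain ⟨F, hF, hq⟩ := List.mem_flatMap.1 hq
  exact sum_transpose_mem_dualValues (hFs F hF) cert.isValid hω
    (fun b hb => (cert.length_and_hasWeight b hb).1) cert.nodup (hclosed F hF) hq

theorem mem_of_mem_admissibleMonomials (cert : IsBasisCertificate k w st Fs B g h C)
    (hω : ω = w.toFinsupp) {x : List ℕ} (hx : x.length = k)
    (hadm : ofList k x ∈ admissibleMonomials k ω) : x ∈ B :=
  cert.survivors_subset x (mem_survivors cert.isValid hω hx hadm)

theorem weight_ofList (cert : IsBasisCertificate k w st Fs B g h C) (hω : ω = w.toFinsupp)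
    {b : List ℕ} (hb : b ∈ B) : weight (ofList k b) = ω :=
  weight_ofList_of_hasWeight (cert.length_and_hasWeight b hb).1 hω
    (cert.length_and_hasWeight b hb).2

theorem admissibleMonomials_eq (cert : IsBasisCertificate k w st Fs B g h C)
    (hω : ω = w.toFinsupp) (hFs : ∀ F ∈ Fs, IsSubstitution k F) :
    admissibleMonomials k ω = ofList k '' {b | b ∈ B} := by
  ext x
  constructor
  · intro hx
    obtain ⟨l, hl, rfl⟩ := exists_eq_ofList x
    exact ⟨l, cert.mem_of_mem_admissibleMonomials hω hl hx, rfl⟩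
  · rintro ⟨b, hb, rfl⟩
    have hweight := cert.weight_ofList hω hb
    exact ⟨not_inadmissible_of_indicator_mem hb hweight
      (fun _ => cert.mem_of_mem_admissibleMonomials hω)
      (cert.indicator_mem_dualValues hω hFs hb), hweight⟩

theorem generates_cls (cert : IsBasisCertificate k w st Fs B g h C) (hω : ω = w.toFinsupp)
    (hFs : ∀ F ∈ Fs, IsSubstitution k F) : Generates (cls (mono (ofList k g))
      (mono_mem_PLe (cert.weight_ofList hω cert.generator_mem))) := by
  refine generates_cls_mono (cert.weight_ofList hω cert.generator_mem) fun N hN hsubst hg y hy => ?_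
  obtain ⟨l, hl, rfl⟩ := exists_eq_ofList y
  obtain ⟨n, -, hn, -⟩ := cert.images
  exact mono_mem_of_mem_iterate_spread hFs cert.isValid hω
    (fun b hb => (cert.length_and_hasWeight b hb).1) hN hsubst hg
    (hn l (cert.mem_of_mem_admissibleMonomials hω hl hy))

theorem exists_basis_and_generates {e : ℕ → List ℕ} {a : ℕ → Fin k →₀ ℕ}
    (ha : ∀ t, ofList k (e t) = a t) {lo hi t : ℕ} (ht : t ∈ Set.Icc lo hi)
    (cert : IsBasisCertificate k w st Fs ((List.range' lo (hi + 1 - lo)).map e) (e t) h C)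
    (hω : ω = w.toFinsupp) (hFs : ∀ F ∈ Fs, IsSubstitution k F) :
    ∃ hmem : ∀ t ∈ Set.Icc lo hi, mono (a t) ∈ PLe k ω,
      admissibleMonomials k ω = a '' Set.Icc lo hi ∧
      (∃ b : Module.Basis (Set.Icc lo hi) (ZMod 2) (QP k ω),
        ∀ t : Set.Icc lo hi, b t = cls (mono (a t)) (hmem t t.2)) ∧
      Module.finrank (ZMod 2) (QP k ω) = hi + 1 - lo ∧
      Generates (cls (mono (a t)) (hmem t ht)) := by
  have hrange (t : ℕ) : t ∈ List.range' lo (hi + 1 - lo) ↔ t ∈ Set.Icc lo hi := by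
    rw [List.mem_range'_1, Set.mem_Icc]
    omega
  have hadm : admissibleMonomials k ω = a '' Set.Icc lo hi := by
    rw [cert.admissibleMonomials_eq hω hFs, ← funext ha]
    simp only [List.mem_map, hrange]
    exact Set.image_image _ _ _
  have hlen (t : ℕ) (ht : t ∈ Set.Icc lo hi) : (e t).length = k :=
    (cert.length_and_hasWeight _ (List.mem_map_of_mem ((hrange t).2 ht))).1
  have hinj : Set.InjOn a (Set.Icc lo hi) := fun s hs t ht hst => by
    rw [← ha, ← ha, ofList_inj (hlen s hs) (hlen t ht)] at hst
    exact List.inj_on_of_nodup_map cert.nodup ((hrange s).2 hs) ((hrange t).2 ht) hst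
  obtain ⟨hmem, b, hb⟩ := exists_basis_of_admissibleMonomials_eq_image hinj hadm
  refine ⟨hmem, hadm, ⟨b, hb⟩, ?_, ?_⟩
  · rw [Module.finrank_eq_card_basis b]
    simp
  · simp only [← ha]
    exact cert.generates_cls hω hFs

end IsBasisCertificate

end Certificate

section Computation

/-- Rules for monomials whose weight vector starts with `(3, 4)`. -/
def rules34 : List Rule := [
  ⟨[[0, 2, 3, 3, 3]],
    [(1, [0, 1, 3, 3, 3])]⟩,
  ⟨[[2, 1, 2, 3, 3]],
    [(1, [1, 1, 2, 3, 3])]⟩]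

/-- Rules for monomials whose weight vector starts with `(3, 4, 2)`. -/
def rules342 : List Rule := [
  ⟨[[1, 2, 6, 3, 7], [2, 2, 5, 3, 7]],
    [(2, [2, 2, 3, 3, 7])]⟩,
  ⟨[[2, 5, 3, 3, 6], [1, 6, 3, 3, 6]],
    [(2, [2, 3, 3, 3, 6])]⟩]

/-- Rules for monomials whose weight vector starts with `(3, 4, 4)`. -/
def rules344 : List Rule := [
  ⟨[[2, 5, 6, 7, 7], [1, 6, 6, 7, 7]],
    [(2, [2, 3, 6, 7, 7])]⟩,
  ⟨[[5, 3, 6, 6, 7]],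
    [(2, [3, 3, 6, 6, 7])]⟩]

/-- Rules for monomials whose weight vector starts with `(3, 4, 4, 1)`. -/
def rules3441 : List Rule := [
  ⟨[[5, 6, 6, 11, 7], [3, 5, 6, 14, 7], [3, 6, 6, 13, 7]],
    [(4, [5, 6, 6, 7, 7])]⟩]

/-- Rules for monomials whose weight vector starts with `(3, 4, 2, 2)`. -/
def rules3422 : List Rule := [
  ⟨[[1, 2, 6, 11, 15], [1, 2, 10, 7, 15], [2, 2, 9, 7, 15], [2, 2, 5, 11, 15]],
    [(4, [1, 2, 6, 7, 15])]⟩,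
  ⟨[[2, 3, 9, 6, 15]],
    [(4, [1, 3, 6, 6, 15])]⟩,
  ⟨[[1, 3, 6, 11, 14], [2, 3, 9, 7, 14], [2, 6, 9, 7, 11], [2, 3, 6, 11, 13], [2, 3, 5, 11, 14],
   [1, 3, 10, 7, 14], [1, 6, 10, 7, 11], [2, 5, 10, 7, 11], [1, 10, 6, 11, 7], [2, 9, 6, 11, 7]],
    [(4, [1, 3, 6, 7, 14])]⟩,
  ⟨[[3, 9, 6, 7, 10], [3, 5, 6, 11, 10], [3, 6, 6, 11, 9], [6, 3, 5, 11, 10], [10, 3, 5, 7, 10]],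
    [(4, [3, 5, 6, 7, 10])]⟩,
  ⟨[[1, 2, 11, 7, 14], [2, 2, 11, 7, 13]],
    [(4, [1, 2, 7, 7, 14])]⟩,
  ⟨[[3, 3, 9, 6, 14]],
    [(4, [3, 3, 5, 6, 14])]⟩,
  ⟨[[2, 9, 7, 7, 10], [1, 6, 11, 7, 10], [2, 5, 11, 7, 10], [1, 10, 7, 7, 10]],
    [(4, [1, 6, 7, 7, 10])]⟩,
  ⟨[[1, 2, 10, 7, 15], [2, 2, 9, 7, 15], [1, 2, 3, 14, 15], [2, 2, 3, 13, 15]],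
    [(2, [1, 1, 5, 11, 15]), (6, [1, 1, 5, 7, 15]), (4, [1, 1, 5, 9, 15]), (8, [1, 1, 5, 7, 13]),
     (4, [1, 1, 5, 11, 13])]⟩,
  ⟨[[1, 6, 6, 11, 11], [2, 5, 6, 11, 11], [1, 3, 6, 14, 11], [2, 3, 5, 14, 11], [2, 3, 6, 13, 11],
   [2, 3, 3, 13, 14], [2, 9, 6, 7, 11], [1, 3, 3, 14, 14], [1, 10, 6, 7, 11]],
    [(4, [1, 6, 6, 7, 11])]⟩,
  ⟨[[1, 2, 2, 15, 15]],
    [(2, [1, 1, 1, 15, 15]), (4, [1, 1, 1, 15, 13]), (4, [1, 1, 1, 13, 15]), (2, [1, 1, 1, 11,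
     19]), (8, [1, 1, 1, 11, 13])]⟩,
  ⟨[[1, 3, 6, 10, 15], [2, 3, 5, 10, 15]],
    [(2, [1, 3, 5, 9, 15]), (4, [1, 3, 3, 9, 15]), (4, [1, 3, 3, 5, 19]), (8, [1, 5, 3, 5, 13]),
     (2, [1, 3, 5, 5, 19]), (4, [1, 9, 3, 5, 13])]⟩,
  ⟨[[2, 3, 13, 10, 7], [1, 3, 14, 10, 7], [1, 10, 7, 10, 7], [2, 9, 7, 10, 7], [2, 9, 7, 3, 14],
   [1, 3, 14, 3, 14], [2, 3, 13, 3, 14]],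
    [(2, [1, 5, 7, 9, 11]), (4, [1, 3, 7, 9, 11]), (4, [1, 3, 11, 9, 7]), (2, [1, 5, 11, 9, 7]),
     (4, [1, 3, 13, 5, 9]), (8, [1, 3, 9, 5, 9]), (4, [1, 3, 9, 5, 13])]⟩,
  ⟨[[3, 3, 5, 10, 14], [3, 3, 6, 10, 13], [10, 3, 5, 10, 7], [9, 3, 6, 10, 7]],
    [(2, [3, 5, 5, 9, 11]), (4, [3, 3, 3, 9, 13]), (4, [3, 3, 3, 5, 17]), (2, [3, 3, 5, 5, 17]),
     (8, [5, 5, 3, 5, 9]), (4, [5, 3, 3, 9, 11]), (4, [9, 3, 3, 9, 7]), (2, [9, 3, 5, 9, 7]), (4,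
     [5, 9, 3, 5, 9])]⟩,
  ⟨[[3, 5, 10, 6, 11], [3, 9, 10, 6, 7], [3, 3, 5, 10, 14]],
    [(8, [3, 5, 6, 6, 7])]⟩]

/-- The stages for `ω_(4)`. A stage reduces leading terms by the stages after it only, hence the
repetition. -/
def stages4 : List Stage :=
  List.replicate 3 ⟨[3, 4, 2, 2], rules3422⟩ ++ [⟨[3, 4, 2], rules342⟩, ⟨[3, 4], rules34⟩]

/-- The stages for `ω_(5)`. -/
def stages5 : List Stage :=
  [⟨[3, 4, 4, 1], rules3441⟩, ⟨[3, 4, 4], rules344⟩, ⟨[3, 4], rules34⟩]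

/-- The monomials of a functional on `QP_5(ω_(4))` which takes the value `1` on
`(7, 11, 13, 2, 2)` and vanishes on all other admissible monomials. -/
def functional4 : List (List ℕ) :=
  [[7, 11, 13, 2, 2], [7, 11, 14, 1, 2], [7, 11, 14, 2, 1], [7, 13, 11, 2, 2], [7, 14, 11, 1, 2],
   [7, 14, 11, 2, 1], [11, 7, 13, 2, 2], [11, 7, 14, 1, 2], [11, 7, 14, 2, 1], [11, 13, 7, 2, 2],
   [11, 14, 7, 1, 2], [11, 14, 7, 2, 1], [13, 7, 11, 2, 2], [13, 11, 7, 2, 2], [14, 7, 11, 1, 2],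
   [14, 7, 11, 2, 1], [14, 11, 7, 1, 2], [14, 11, 7, 2, 1], [7, 13, 13, 1, 1], [13, 7, 13, 1, 1],
   [13, 13, 7, 1, 1], [11, 11, 11, 1, 1], [7, 7, 19, 1, 1], [7, 19, 7, 1, 1], [19, 7, 7, 1, 1],
   [11, 7, 15, 1, 1], [11, 15, 7, 1, 1], [15, 11, 7, 1, 1]]

/-- The monomials of a functional on `QP_5(ω_(5))` which takes the value `1` on
`(15, 3, 5, 6, 6)` and vanishes on all other admissible monomials. -/
def functional5 : List (List ℕ) :=
  [[15, 3, 5, 6, 6], [15, 3, 6, 5, 6], [15, 3, 6, 6, 5], [15, 5, 3, 6, 6], [15, 5, 6, 3, 6],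
   [15, 5, 6, 6, 3], [15, 6, 3, 5, 6], [15, 6, 3, 6, 5], [15, 6, 5, 3, 6], [15, 6, 5, 6, 3],
   [15, 6, 6, 3, 5], [15, 6, 6, 5, 3], [15, 5, 5, 5, 5], [15, 3, 3, 9, 5], [15, 3, 9, 3, 5],
   [15, 3, 9, 5, 3], [15, 5, 3, 9, 3], [15, 9, 3, 3, 5], [15, 9, 5, 3, 3], [15, 5, 3, 7, 5],
   [15, 5, 7, 3, 5], [15, 5, 7, 5, 3], [15, 7, 5, 3, 5], [23, 3, 3, 3, 3], [15, 3, 3, 11, 3],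
   [15, 11, 3, 3, 3]]

/-- Substitutions which correspond to generators of `GL_5(𝔽₂)`. -/
def substitutions : List (List ℕ → List (List ℕ)) :=
  [transvect, fun x => [permute [1, 0, 2, 3, 4] x], fun x => [permute [1, 2, 3, 4, 0] x]]

/-- The exponents of `a_t`. -/
def exponents (t : ℕ) : List ℕ := List.ofFn ((aTable.lookup t).getD 0)

theorem ofList_exponents (t : ℕ) : ofList 5 (exponents t) = a t := ofList_ofFn _

theorem isSubstitution_of_mem_substitutions : ∀ F ∈ substitutions, IsSubstitution 5 F := by
  simp only [substitutions, List.forall_mem_cons]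
  exact ⟨isSubstitution_transvect, isSubstitution_permute (by decide),
    isSubstitution_permute (by decide), by simp⟩

set_option maxHeartbeats 4000000 in
-- The kernel reduces the images of all monomials in `B` and the candidates for further ones.
set_option maxRecDepth 100000 in
theorem isBasisCertificate_omega4 : IsBasisCertificate 5 [3, 4, 2, 2] stages4 substitutions
    ((List.range' 161 (210 + 1 - 161)).map exponents) (exponents 203) [7, 11, 13, 2, 2]
    functional4 where
  isValid := by decide +kernel
  nodup := by decide +kernel
  length_and_hasWeight := by decide +kernel
  survivors_subset := by decide +kernel
  generator_mem := by decide +kernel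
  isAnnihilating := ⟨35, by decide +kernel⟩
  separates := by decide +kernel
  images := ⟨7, by decide +kernel⟩

theorem isBasisCertificate_omega5 : IsBasisCertificate 5 [3, 4, 4, 1] stages5 substitutions
    ((List.range' 211 (225 + 1 - 211)).map exponents) (exponents 225) [15, 3, 5, 6, 6]
    functional5 where
  isValid := by decide +kernel
  nodup := by decide +kernel
  length_and_hasWeight := by decide +kernel
  survivors_subset := by decide +kernel
  generator_mem := by decide +kernel
  isAnnihilating := ⟨35, by decide +kernel⟩
  separates := by decide +kernel
  images := ⟨7, by decide +kernel⟩

end Computation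

end HitProblem

theorem mainTheorem7 :
    (∃ hmem : ∀ t ∈ Set.Icc (161 : ℕ) 210,
        HitProblem.mono (HitProblem.a t) ∈ HitProblem.PLe 5 HitProblem.omega4,
      HitProblem.admissibleMonomials 5 HitProblem.omega4
        = HitProblem.a '' Set.Icc (161 : ℕ) 210 ∧
      (∃ b : Module.Basis (Set.Icc (161 : ℕ) 210) (ZMod 2) (HitProblem.QP 5 HitProblem.omega4),
        ∀ t : Set.Icc (161 : ℕ) 210,
          b t = HitProblem.cls (HitProblem.mono (HitProblem.a t)) (hmem t t.2)) ∧
      Module.finrank (ZMod 2) (HitProblem.QP 5 HitProblem.omega4) = 50 ∧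
      HitProblem.Generates
        (HitProblem.cls (HitProblem.mono (HitProblem.a 203)) (hmem 203 (by simp)))) ∧
    (∃ hmem : ∀ t ∈ Set.Icc (211 : ℕ) 225,
        HitProblem.mono (HitProblem.a t) ∈ HitProblem.PLe 5 HitProblem.omega5,
      HitProblem.admissibleMonomials 5 HitProblem.omega5
        = HitProblem.a '' Set.Icc (211 : ℕ) 225 ∧
      (∃ b : Module.Basis (Set.Icc (211 : ℕ) 225) (ZMod 2) (HitProblem.QP 5 HitProblem.omega5),
        ∀ t : Set.Icc (211 : ℕ) 225,
          b t = HitProblem.cls (HitProblem.mono (HitProblem.a t)) (hmem t t.2)) ∧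
      Module.finrank (ZMod 2) (HitProblem.QP 5 HitProblem.omega5) = 15 ∧
      HitProblem.Generates
        (HitProblem.cls (HitProblem.mono (HitProblem.a 225)) (hmem 225 (by simp)))) := by
  exact
    ⟨HitProblem.isBasisCertificate_omega4.exists_basis_and_generates HitProblem.ofList_exponents
        (by simp) rfl HitProblem.isSubstitution_of_mem_substitutions,
      HitProblem.isBasisCertificate_omega5.exists_basis_and_generates HitProblem.ofList_exponents
        (by simp) rfl HitProblem.isSubstitution_of_mem_substitutions⟩
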